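/- Fix $n$ and variables $X_1,\dots,X_n$ holding nonnegative integers. Commands of $L_r$ are $C ::= \mathtt{skip}\mid X_l:=e\mid C_1;C_2\mid \mathtt{loop}\ X_\ell\,\{C\}\mid \mathtt{choose}\ C_1\ \mathtt{or}\ C_2$ with $e ::= X_r\mid X_r+X_s\ (r\neq s)\mid X_r*X_s\mid 0$, where $X_\ell$ is not assigned in the body of $\mathtt{loop}\ X_\ell\,\{C\}$. *Semantics.* $[\![C]\!]\subseteq\mathbb N^n\times\mathbb N^n$: $\mathtt{skip}$ is the identity; $X_l:=e$ stores in $X_l$ the value of $e$ (or, in an alternative semantics, an arbitrary natural number bounded by that value); $;$ is composition of relations, $\mathtt{choose}$ is union, and $\vec x\,[\![\mathtt{loop}\ X_\ell\{C\}]\!]\,\vec y$ iff $\vec x\,[\![C]\!]^k\,\vec y$ for some $k\le x_\ell$. *Dependences.* The types are $1<1^+<2<3$ with maximum $\sqcup$; $\alpha\simeq1$ means $\alpha\in\{1,1^+\}$. A dependence is either unary, $i\xrightarrow{\delta}j$, or binary, $(i,i')\rightrightarrows(j,j')$. Partial composition: $(i\xrightarrow{\alpha}j)\cdot(j\xrightarrow{\beta}k)=i\xrightarrow{\alpha\sqcup\beta}k$;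 $(i\xrightarrow{\alpha}j)\cdot((j,j)\rightrightarrows(k,k'))=(i,i)\rightrightarrows(k,k')$ if $\alpha\simeq1$; $((i,i')\rightrightarrows(j,j))\cdot(j\xrightarrow{\alpha}k)=(i,i')\rightrightarrows(k,k)$ if $\alpha\simeq1$; $((i,i')\rightrightarrows(j,j'))\cdot((j,j')\rightrightarrows(k,k'))$ is $(i,i')\rightrightarrows(k,k')$ if $i\ne i'$ or $k\neq k'$, and $i\xrightarrow{2}k$ if $i=i'$ and $k=k'$. Longer products associate to the left. Partial loop correction: $LC_\ell(i\xrightarrow{1^+}i)=\ell\xrightarrow{2}i$, $LC_\ell(i\xrightarrow{2}i)=\ell\xrightarrow{3}i$. *Judgements* $C,P\vdash D,Q$ with contexts $P,Q\subseteq\{1,\dots,n\}$ (sets of variables holding zero) are derived by the following rules. - $\mathtt{skip},P\vdash i\xrightarrow{1}i,\,P$ if $i\notin P$. - For $X_l:=e$ with pre-context $P$, the post-context $Q$ is $P\setminus\{l\}$, together with $l$ in case $e$ is $0$; or $e$ is $X_r$ with $r\in P$; or $e$ is $X_r*X_s$ with $r\in P$ or $s\in P$; or $e$ is $X_r+X_s$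 with $r,s\in P$. Derivable are: $i\xrightarrow{1}i$ for $i\notin P$, $i\ne l$; for $e=X_r$: $r\xrightarrow{1}l$ if $r\notin P$; for $e=X_r*X_s$: $r\xrightarrow{2}l$ and $s\xrightarrow{2}l$ if $r,s\notin P$; for $e=X_r+X_s$: $r\xrightarrow{1}l$ if $r\notin P$, $s\in P$; $s\xrightarrow{1}l$ if $r\in P$, $s\notin P$; $r\xrightarrow{1^+}l$ and $s\xrightarrow{1^+}l$ if $r,s\notin P$. - For $C$ either $\mathtt{skip}$ or an assignment: if $C,P\vdash i\xrightarrow{\delta_1}j,Q$ and $C,P\vdash i'\xrightarrow{\delta_2}j',Q$ with $\delta_1,\delta_2\simeq1$, $i,i'\notin P$, $j,j'\notin Q$, and $i\ne i'$ or $j\ne j'$, then $C,P\vdash(i,i')\rightrightarrows(j,j'),Q$. - Choice: if $C_1,P\vdash D,Q$ or $C_2,P\vdash D,Q$, then $\mathtt{choose}\ C_1\ \mathtt{or}\ C_2,P\vdash D,Q$. - Sequence: if $C_1,P\vdash D_1,Q$ and $C_2,Q\vdash D_2,R$ and $D_1\cdot D_2$ is defined, then $C_1;C_2,P\vdash D_1\cdot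 D_2,R$. - (L0) If $\mathtt{skip},P\vdash D,P$ then $\mathtt{loop}\ X_\ell\{C\},P\vdash D,P$. - (L1) If $\ell\notin P_0$, $m\ge1$, $C,P_{k-1}\vdash D_k,P_k$ for $1\le k\le m$, and $D_1\cdots D_m$ is defined, then $\mathtt{loop}\ X_\ell\{C\},P_0\vdash D_1\cdots D_m,P_m$. - (L2) If $\ell\notin P_0$, and for $L=\mathtt{loop}\ X_\ell\{C\}$ we have $L,P_0\vdash D_1,P_1$; $L,P_1\vdash D_2,P_1$; $L,P_1\vdash D_3,P_3$, and $D_1\cdot LC_\ell(D_2)\cdot D_3$ is defined, then $L,P_0\vdash D_1\cdot LC_\ell(D_2)\cdot D_3,P_3$. **Theorem.** Let $C$ be a command of $L_r$ over $X_1,\dots,X_n$ and $1\le j\le n$. Under either semantics of assignments: 1. if $C,\emptyset\vdash i\xrightarrow{3}j,\,Q$ is derivable for some $i$ and $Q$, then there is no polynomial $p\in\mathbb N[x_1,\dots,x_n]$ such that $y_j\le p(\vec x)$ whenever $\vec x\,[\![C]\!]\,\vec y$; 2. if no such judgement is derivable, then there is such a polynomial $p$. -/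

import Mathlib

namespace LoopLang

/-! ### Syntax of the core language over the variables indexed by `Fin n` -/

/-- Expressions: `X_r`, `X_r + X_s`, `X_r * X_s`, `0`. -/
inductive Expr (n : ℕ) : Type
  | var (r : Fin n)
  | add (r s : Fin n)
  | mul (r s : Fin n)
  | zero

/-- Commands. -/
inductive Cmd (n : ℕ) : Type
  | skip
  | assign (l : Fin n) (e : Expr n)
  | seq (C₁ C₂ : Cmd n)
  | loop (ℓ : Fin n) (C : Cmd n)
  | choose (C₁ C₂ : Cmd n)

variable {n : ℕ}

/-- The two operands of an addition are distinct variables. -/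
def Expr.WellFormed : Expr n → Prop
  | .add r s => r ≠ s
  | _ => True

/-- `C.Assigns v`: the variable `v` occurs on the left-hand side of an assignment in `C`. -/
def Cmd.Assigns (v : Fin n) : Cmd n → Prop
  | .skip => False
  | .assign l _ => l = v
  | .seq C₁ C₂ => C₁.Assigns v ∨ C₂.Assigns v
  | .loop _ C => C.Assigns v
  | .choose C₁ C₂ => C₁.Assigns v ∨ C₂.Assigns v

/-- The syntactic restrictions on commands: a loop variable is not assigned in the body of its
loop, and the two operands of an addition are distinct variables. -/
def Cmd.WellFormed : Cmd n → Prop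
  | .skip => True
  | .assign _ e => e.WellFormed
  | .seq C₁ C₂ => C₁.WellFormed ∧ C₂.WellFormed
  | .loop ℓ C => ¬ C.Assigns ℓ ∧ C.WellFormed
  | .choose C₁ C₂ => C₁.WellFormed ∧ C₂.WellFormed

/-! ### Semantics -/

/-- A store assigns a nonnegative integer to every variable. -/
abbrev Store (n : ℕ) : Type := Fin n → ℕ

/-- The value of an expression in a store. -/
def Expr.eval (x : Store n) : Expr n → ℕ
  | .var r => x r
  | .add r s => x r + x s
  | .mul r s => x r * x s
  | .zero => 0

/-- The two admissible readings of an assignment: the value of the expression is stored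
(`exact`), or an arbitrary nonnegative integer bounded by that value is stored (`bounded`). -/
inductive AssignMode : Type
  | exact
  | bounded

/-- `σ.Allows v w`: when the right-hand side has value `v`, the value `w` may be stored. -/
def AssignMode.Allows : AssignMode → ℕ → ℕ → Prop
  | .exact, v, w => w = v
  | .bounded, v, w => w ≤ v

/-- The `k`-th power of a relation under composition. -/
def relPow {α : Type} (R : α → α → Prop) : ℕ → α → α → Prop
  | 0 => Eq
  | k + 1 => Relation.Comp (relPow R k) R

/-- `C.Rel σ x y`: started in the store `x`, the command `C` may terminate in the store `y`. -/
def Cmd.Rel (σ : AssignMode) : Cmd n → Store n → Store n → Prop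
  | .skip => Eq
  | .assign l e => fun x y => ∃ w, σ.Allows (e.eval x) w ∧ y = Function.update x l w
  | .seq C₁ C₂ => Relation.Comp (C₁.Rel σ) (C₂.Rel σ)
  | .loop ℓ C => fun x y => ∃ k ≤ x ℓ, relPow (C.Rel σ) k x y
  | .choose C₁ C₂ => fun x y => C₁.Rel σ x y ∨ C₂.Rel σ x y

/-- The final values of `X_j` are bounded by a polynomial in the initial values of all the
variables. -/
def Cmd.PolyBounded (σ : AssignMode) (C : Cmd n) (j : Fin n) : Prop :=
  ∃ p : MvPolynomial (Fin n) ℕ, ∀ x y : Store n, C.Rel σ x y → y j ≤ MvPolynomial.eval x p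

/-! ### Dependences -/

/-- The dependence types `1`, `1⁺`, `2`, `3`. -/
inductive DepType : Type
  | one
  | onePlus
  | two
  | three

/-- The position of a dependence type in the order `1 < 1⁺ < 2 < 3`. -/
def DepType.rank : DepType → ℕ
  | .one => 0
  | .onePlus => 1
  | .two => 2
  | .three => 3

theorem DepType.rank_injective : Function.Injective DepType.rank := by
  intro a b h
  cases a <;> cases b <;> first | rfl | exact absurd h (by decide)

noncomputable instance : LinearOrder DepType := LinearOrder.lift' DepType.rank DepType.rank_injective

/-- `δ ≃ 1`, that is, `δ` is `1` or `1⁺`. -/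
def DepType.IsUnit (δ : DepType) : Prop := δ = .one ∨ δ = .onePlus

/-- Dependences: `unary i δ j` is `i →δ j`, and `binary i i' j j'` is the conjunction of a
dependence of `j` on `i` and one of `j'` on `i'`. -/
inductive Dep (n : ℕ) : Type
  | unary (i : Fin n) (δ : DepType) (j : Fin n)
  | binary (i i' j j' : Fin n)

/-- The partial operation of composition of dependences, as a relation:
`Dep.Comp D₁ D₂ D` says that `D₁ · D₂` is defined and equal to `D`. -/
inductive Dep.Comp : Dep n → Dep n → Dep n → Prop
  | unary_unary (i j k : Fin n) (α β : DepType) :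
      Dep.Comp (.unary i α j) (.unary j β k) (.unary i (α ⊔ β) k)
  | unary_binary (i j k k' : Fin n) (α : DepType) (hα : α.IsUnit) :
      Dep.Comp (.unary i α j) (.binary j j k k') (.binary i i k k')
  | binary_unary (i i' j k : Fin n) (α : DepType) (hα : α.IsUnit) :
      Dep.Comp (.binary i i' j j) (.unary j α k) (.binary i i' k k)
  | binary_binary (i i' j j' k k' : Fin n) (h : i ≠ i' ∨ k ≠ k') :
      Dep.Comp (.binary i i' j j') (.binary j j' k k') (.binary i i' k k')
  | binary_binary_eq (i j j' k : Fin n) :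
      Dep.Comp (.binary i i j j') (.binary j j' k k) (.unary i .two k)

/-- `Dep.CompSeq D m E`: the product `D 0 · D 1 · … · D m` (`m + 1` factors, associated to the
left) is defined and equal to `E`. -/
inductive Dep.CompSeq (D : ℕ → Dep n) : ℕ → Dep n → Prop
  | single : Dep.CompSeq D 0 (D 0)
  | snoc {m : ℕ} {E F : Dep n} (h : Dep.CompSeq D m E) (hF : Dep.Comp E (D (m + 1)) F) :
      Dep.CompSeq D (m + 1) F

/-- The partial loop correction operator, as a relation: `Dep.LoopCorr ℓ D E` says that
`LC_ℓ(D)` is defined and equal to `E`. -/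
inductive Dep.LoopCorr (ℓ : Fin n) : Dep n → Dep n → Prop
  | onePlus (i : Fin n) : Dep.LoopCorr ℓ (.unary i .onePlus i) (.unary ℓ .two i)
  | two (i : Fin n) : Dep.LoopCorr ℓ (.unary i .two i) (.unary ℓ .three i)

/-! ### The proof system -/

/-- A context: a set of variables that hold zero. -/
abbrev Ctx (n : ℕ) : Type := Finset (Fin n)

/-- `(P \ {l}) ∪ {l | b}`. -/
def Ctx.set (P : Ctx n) (l : Fin n) (b : Prop) [Decidable b] : Ctx n :=
  if b then insert l P else P.erase l

/-- `skip` and assignments. -/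
def Cmd.IsAtomic : Cmd n → Prop
  | .skip => True
  | .assign _ _ => True
  | _ => False

/-- `Derives C P D Q`: the judgement `C, P ⊢ D, Q` is provable. -/
inductive Derives : Cmd n → Ctx n → Dep n → Ctx n → Prop
  | skip {P : Ctx n} {i : Fin n} (hi : i ∉ P) :
      Derives .skip P (.unary i .one i) P
  | zero {P : Ctx n} {l i : Fin n} (hi : i ∉ P) (hil : i ≠ l) :
      Derives (.assign l .zero) P (.unary i .one i) (P ∪ {l})
  | var_other {P : Ctx n} {l r i : Fin n} (hi : i ∉ P) (hil : i ≠ l) :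
      Derives (.assign l (.var r)) P (.unary i .one i) (P.set l (r ∈ P))
  | var_self {P : Ctx n} {l r : Fin n} (hr : r ∉ P) :
      Derives (.assign l (.var r)) P (.unary r .one l) (P.set l (r ∈ P))
  | mul_other {P : Ctx n} {l r s i : Fin n} (hi : i ∉ P) (hil : i ≠ l) :
      Derives (.assign l (.mul r s)) P (.unary i .one i) (P.set l (r ∈ P ∨ s ∈ P))
  | mul_self {P : Ctx n} {l r s t : Fin n} (hr : r ∉ P) (hs : s ∉ P) (ht : t = r ∨ t = s) :
      Derives (.assign l (.mul r s)) P (.unary t .two l) (P.set l (r ∈ P ∨ s ∈ P))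
  | add_other {P : Ctx n} {l r s i : Fin n} (hrs : r ≠ s) (hi : i ∉ P) (hil : i ≠ l) :
      Derives (.assign l (.add r s)) P (.unary i .one i) (P.set l (r ∈ P ∧ s ∈ P))
  | add_left {P : Ctx n} {l r s : Fin n} (hrs : r ≠ s) (hr : r ∉ P) (hs : s ∈ P) :
      Derives (.assign l (.add r s)) P (.unary r .one l) (P.set l (r ∈ P ∧ s ∈ P))
  | add_right {P : Ctx n} {l r s : Fin n} (hrs : r ≠ s) (hr : r ∈ P) (hs : s ∉ P) :
      Derives (.assign l (.add r s)) P (.unary s .one l) (P.set l (r ∈ P ∧ s ∈ P))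
  | add_both {P : Ctx n} {l r s t : Fin n} (hrs : r ≠ s) (hr : r ∉ P) (hs : s ∉ P)
      (ht : t = r ∨ t = s) :
      Derives (.assign l (.add r s)) P (.unary t .onePlus l) (P.set l (r ∈ P ∧ s ∈ P))
  | atomic_binary {C : Cmd n} {P Q : Ctx n} {i i' j j' : Fin n} {δ₁ δ₂ : DepType}
      (hC : C.IsAtomic) (hi : i ∉ P) (hi' : i' ∉ P) (hj : j ∉ Q) (hj' : j' ∉ Q)
      (hne : i ≠ i' ∨ j ≠ j') (hδ₁ : δ₁.IsUnit) (hδ₂ : δ₂.IsUnit)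
      (h₁ : Derives C P (.unary i δ₁ j) Q) (h₂ : Derives C P (.unary i' δ₂ j') Q) :
      Derives C P (.binary i i' j j') Q
  | choose_left {C₁ C₂ : Cmd n} {P Q : Ctx n} {D : Dep n} (h : Derives C₁ P D Q) :
      Derives (.choose C₁ C₂) P D Q
  | choose_right {C₁ C₂ : Cmd n} {P Q : Ctx n} {D : Dep n} (h : Derives C₂ P D Q) :
      Derives (.choose C₁ C₂) P D Q
  | seq {C₁ C₂ : Cmd n} {P Q R : Ctx n} {D₁ D₂ D : Dep n}
      (h₁ : Derives C₁ P D₁ Q) (h₂ : Derives C₂ Q D₂ R) (hD : Dep.Comp D₁ D₂ D) :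
      Derives (.seq C₁ C₂) P D R
  /-- No iteration of the body. -/
  | loop_zero {ℓ : Fin n} {C : Cmd n} {P : Ctx n} {D : Dep n} (h : Derives .skip P D P) :
      Derives (.loop ℓ C) P D P
  /-- A positive number `m + 1` of iterations of the body. -/
  | loop_iter {ℓ : Fin n} {C : Cmd n} (m : ℕ) (P : ℕ → Ctx n) (D : ℕ → Dep n) {E : Dep n}
      (hℓ : ℓ ∉ P 0) (h : ∀ k ≤ m, Derives C (P k) (D k) (P (k + 1)))
      (hE : Dep.CompSeq D m E) :
      Derives (.loop ℓ C) (P 0) E (P (m + 1))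
  /-- Loop correction, between a preamble and a continuation. -/
  | loop_corr {ℓ : Fin n} {C : Cmd n} {P₀ P₁ P₃ : Ctx n} {D₁ D₂ D₂' D₃ E F : Dep n}
      (hℓ : ℓ ∉ P₀)
      (h₁ : Derives (.loop ℓ C) P₀ D₁ P₁)
      (h₂ : Derives (.loop ℓ C) P₁ D₂ P₁)
      (h₃ : Derives (.loop ℓ C) P₁ D₃ P₃)
      (hLC : Dep.LoopCorr ℓ D₂ D₂') (hE : Dep.Comp D₁ D₂' E) (hF : Dep.Comp E D₃ F) :
      Derives (.loop ℓ C) P₀ F P₃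

end LoopLang

/-! The upper bound is proved for the bounded semantics and the lower bound for the exact one. Every
exact run is also a bounded run, so each bound holds in both semantics.

Upper bound. Every run, started in a context of known zeros, is accompanied by a matrix over ℕ of
simultaneously derivable dependences. Matrix products count paths, and an entry at least 2 of a
product arises either from such an entry of a factor or from two different unit paths. These are the
two ways in which composition yields type 2: through a unary dependence of type 2, or through a
binary dependence that splits and rejoins (`Valid.mul`). An additional index for the constant 1
records type `1⁺`: a column is wide if its entry in that row is at least 2, and a narrow column is a
mere copy. A final value is bounded by the unit entries of its column, as summands with coefficient
1, plus a monomial in the sum over the remaining nonzero entries, with a constant that does not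
depend on the run.

For `T` iterations of a loop body, consider two times with the same context and a variable `k` with
a nonzero diagonal entry in the segment between them, such that `k` leads on to the target `j`. If
the entry is at least 2, loop correction derives type 3. If it is 1 in a wide column, loop
correction derives type 2 from `ℓ`, which pays for growth polynomial in `T ≤ x ℓ`. If neither kind
of cycle exists, the growth must be bounded independently of `T`. The last point, and polynomial
growth in the absence of cycles of the first kind, are statements about sequences of matrices
(`exists_growth_of_no_wide_cycle`, `exists_growth_of_no_double_cycle`). There are finitely many
pairs of a context and a variable, so a rank counting the pairs met so far increases only boundedly
often along a path. `hasBound_loop` combines the cases.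

Lower bound. From a store whose nonzero values are all at least a large `N`, some run realizes a
given derivable dependence: types `1`, `1⁺`, `2`, `3` force final values at least `a`, `a + N`, `2 *
a`, `2 ^ (a / c)`. Doubling suffices for type 2, because iterated doubling is exponential. For loop
correction the three ingredients must use a fixed number of iterations. They do: since `ℓ` is not
assigned, a corrected dependence leads from `ℓ` to another variable, and such a dependence cannot be
an ingredient of a further correction (`Derives.exists_realizes`). -/

namespace LoopLang

open Finset

/-! ### Functions bounded by a polynomial without constant term -/

/-- `f` is bounded by a monomial `K * Z ^ K`; in particular `f 0 = 0`. -/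
def MonoBdd (f : ℕ → ℕ) : Prop := ∃ K, ∀ Z, f Z ≤ K * Z ^ K

/-- The factor `K` covers the case `K = 0`, where the power is 1. Bounds of this shape vanish at 0,
so a column without entries at least 2 contributes no error term. -/
theorem zero_mul_pow (K : ℕ) : K * 0 ^ K = 0 := by
  rcases K with _ | K <;> simp

theorem mul_pow_mono {K K' Z Z' : ℕ} (hK : K ≤ K') (hZ : Z ≤ Z') : K * Z ^ K ≤ K' * Z' ^ K' := by
  rcases Nat.eq_zero_or_pos Z with rfl | h
  · simp [zero_mul_pow]
  · exact Nat.mul_le_mul hK ((Nat.pow_le_pow_left hZ K).trans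
      (Nat.pow_le_pow_right (h.trans_le hZ) hK))

theorem MonoBdd.of_le {f : ℕ → ℕ} (a b : ℕ) (h0 : f 0 = 0)
    (h : ∀ Z, 1 ≤ Z → f Z ≤ a * Z ^ b) : MonoBdd f := by
  refine ⟨a + b, fun Z => ?_⟩
  rcases Nat.eq_zero_or_pos Z with rfl | hZ
  · simp [h0]
  · exact (h Z hZ).trans (Nat.mul_le_mul (by omega) (Nat.pow_le_pow_right hZ (by omega)))

theorem MonoBdd.zero {f : ℕ → ℕ} (h : MonoBdd f) : f 0 = 0 := by
  obtain ⟨K, hK⟩ := h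
  have := hK 0
  rw [zero_mul_pow] at this
  omega

theorem MonoBdd.mono {f g : ℕ → ℕ} (h : MonoBdd g) (hfg : ∀ Z, f Z ≤ g Z) : MonoBdd f := by
  obtain ⟨K, hK⟩ := h
  exact ⟨K, fun Z => (hfg Z).trans (hK Z)⟩

theorem monoBdd_id : MonoBdd fun Z => Z := ⟨1, fun Z => by simp⟩

theorem MonoBdd.add {f g : ℕ → ℕ} (hf : MonoBdd f) (hg : MonoBdd g) :
    MonoBdd fun Z => f Z + g Z := by
  obtain ⟨K, hK⟩ := hf
  obtain ⟨K', hK'⟩ := hg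
  refine .of_le (K + K') (K + K') (by simp [MonoBdd.zero ⟨K, hK⟩, MonoBdd.zero ⟨K', hK'⟩])
    fun Z hZ => ?_
  rw [add_mul]
  exact add_le_add ((hK Z).trans (Nat.mul_le_mul le_rfl (Nat.pow_le_pow_right hZ (by omega))))
    ((hK' Z).trans (Nat.mul_le_mul le_rfl (Nat.pow_le_pow_right hZ (by omega))))

theorem MonoBdd.mul {f g : ℕ → ℕ} (hf : MonoBdd f) (hg : MonoBdd g) :
    MonoBdd fun Z => f Z * g Z := by
  obtain ⟨K, hK⟩ := hf
  obtain ⟨K', hK'⟩ := hg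
  refine .of_le (K * K') (K + K') (by simp [MonoBdd.zero ⟨K, hK⟩]) fun Z hZ => ?_
  calc f Z * g Z ≤ (K * Z ^ K) * (K' * Z ^ K') := Nat.mul_le_mul (hK Z) (hK' Z)
    _ = _ := by rw [pow_add]; ring

theorem MonoBdd.const_mul {f : ℕ → ℕ} (a : ℕ) (hf : MonoBdd f) : MonoBdd fun Z => a * f Z := by
  obtain ⟨K, hK⟩ := hf
  refine .of_le (a * K) K (by simp [MonoBdd.zero ⟨K, hK⟩]) fun Z hZ => ?_
  rw [mul_assoc]
  exact Nat.mul_le_mul le_rfl (hK Z)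

theorem MonoBdd.monomial {f : ℕ → ℕ} (K : ℕ) (hf : MonoBdd f) :
    MonoBdd fun Z => K * f Z ^ K := by
  obtain ⟨L, hL⟩ := hf
  refine .of_le (K * L ^ K) (L * K) (by simp [MonoBdd.zero ⟨L, hL⟩, zero_mul_pow]) fun Z hZ => ?_
  calc K * f Z ^ K ≤ K * (L * Z ^ L) ^ K := Nat.mul_le_mul le_rfl (Nat.pow_le_pow_left (hL Z) K)
    _ = _ := by rw [mul_pow, ← pow_mul]; ring

/-! ### Matrices of natural numbers and products of their segments -/

section Matrices

variable {ι : Type*} [Fintype ι]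

theorem entry_mul_le (A B : Matrix ι ι ℕ) (i j k : ι) : A i j * B j k ≤ (A * B) i k := by
  rw [Matrix.mul_apply]
  exact Finset.single_le_sum (f := fun j => A i j * B j k) (fun _ _ => Nat.zero_le _) (mem_univ j)

theorem entry_mul_ne_zero {A B : Matrix ι ι ℕ} {i j k : ι} (h : A i j ≠ 0) (h' : B j k ≠ 0) :
    (A * B) i k ≠ 0 := by
  have := entry_mul_le A B i j k
  have : 0 < A i j * B j k := Nat.mul_pos (Nat.pos_of_ne_zero h) (Nat.pos_of_ne_zero h')
  omega

theorem two_le_entry_mul_left {A B : Matrix ι ι ℕ} {i j k : ι} (h : 2 ≤ A i j) (h' : B j k ≠ 0) :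
    2 ≤ (A * B) i k :=
  (h.trans (Nat.le_mul_of_pos_right _ (Nat.pos_of_ne_zero h'))).trans (entry_mul_le A B i j k)

theorem two_le_entry_mul_right {A B : Matrix ι ι ℕ} {i j k : ι} (h : A i j ≠ 0) (h' : 2 ≤ B j k) :
    2 ≤ (A * B) i k :=
  (h'.trans (Nat.le_mul_of_pos_left _ (Nat.pos_of_ne_zero h))).trans (entry_mul_le A B i j k)

theorem exists_of_entry_mul_ne_zero {A B : Matrix ι ι ℕ} {i k : ι} (h : (A * B) i k ≠ 0) :
    ∃ j, A i j ≠ 0 ∧ B j k ≠ 0 := by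
  rw [Matrix.mul_apply] at h
  obtain ⟨j, -, hj⟩ := Finset.exists_ne_zero_of_sum_ne_zero h
  exact ⟨j, left_ne_zero_of_mul hj, right_ne_zero_of_mul hj⟩

theorem two_le_entry_mul_of_ne {A B : Matrix ι ι ℕ} {i j j' k : ι} (hjj' : j ≠ j')
    (h1 : A i j ≠ 0) (h2 : B j k ≠ 0) (h3 : A i j' ≠ 0) (h4 : B j' k ≠ 0) :
    2 ≤ (A * B) i k := by
  classical
  have h := Finset.sum_le_sum_of_subset (f := fun j => A i j * B j k) (subset_univ {j, j'})
  rw [Finset.sum_pair hjj', ← Matrix.mul_apply] at h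
  have : 0 < A i j * B j k := Nat.mul_pos (Nat.pos_of_ne_zero h1) (Nat.pos_of_ne_zero h2)
  have : 0 < A i j' * B j' k := Nat.mul_pos (Nat.pos_of_ne_zero h3) (Nat.pos_of_ne_zero h4)
  omega

/-- If all contributing entries are 1, the product entry counts intermediate indices, so there are
two of them. The alternatives match the unary and the binary origin of type 2. -/
theorem of_two_le_entry_mul {A B : Matrix ι ι ℕ} {i k : ι} (h : 2 ≤ (A * B) i k) :
    (∃ j, A i j ≠ 0 ∧ B j k ≠ 0 ∧ (2 ≤ A i j ∨ 2 ≤ B j k)) ∨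
      ∃ j j', j ≠ j' ∧ A i j = 1 ∧ B j k = 1 ∧ A i j' = 1 ∧ B j' k = 1 := by
  by_contra! hc
  obtain ⟨h1, h2⟩ := hc
  obtain ⟨j, hj, hj'⟩ := exists_of_entry_mul_ne_zero (A := A) (B := B) (i := i) (k := k) (by omega)
  have key : ∀ j, A i j ≠ 0 → B j k ≠ 0 → A i j = 1 ∧ B j k = 1 := fun j hj hj' => by
    have := h1 j hj hj'
    omega
  have hsum : (A * B) i k = A i j * B j k := by
    rw [Matrix.mul_apply]
    refine Finset.sum_eq_single j (fun j' _ hne => ?_) (by simp)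
    by_contra hz
    have e1 := key j hj hj'
    have e2 := key j' (left_ne_zero_of_mul hz) (right_ne_zero_of_mul hz)
    exact h2 j j' hne.symm e1.1 e1.2 e2.1 e2.2
  rw [hsum, (key j hj hj').1, (key j hj hj').2] at h
  omega

theorem of_entry_mul_eq_one {A B : Matrix ι ι ℕ} {i k : ι} (h : (A * B) i k = 1) :
    ∃ j, A i j = 1 ∧ B j k = 1 := by
  obtain ⟨j, hj, hj'⟩ := exists_of_entry_mul_ne_zero (A := A) (B := B) (i := i) (k := k) (by omega)
  have h1 : ¬ 2 ≤ A i j := fun h2 => by have := two_le_entry_mul_left h2 hj'; omega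
  have h2 : ¬ 2 ≤ B j k := fun h2 => by have := two_le_entry_mul_right hj h2; omega
  exact ⟨j, by omega, by omega⟩

/-- The bound on a final value described by a column of a matrix: entries `1` stand for summands,
larger entries for the variables of a polynomial. -/
def growth (K : ℕ) (A : Matrix ι ι ℕ) (x : ι → ℕ) (j : ι) : ℕ :=
  ∑ i with A i j = 1, x i + K * (∑ i with 2 ≤ A i j, x i) ^ K

theorem growth_mono {K K' : ℕ} (h : K ≤ K') (A : Matrix ι ι ℕ) (x : ι → ℕ) (j : ι) :
    growth K A x j ≤ growth K' A x j :=
  Nat.add_le_add_left (mul_pow_mono h le_rfl) _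

theorem growth_le_of_le {K b : ℕ} {A : Matrix ι ι ℕ} {x : ι → ℕ} {j : ι}
    (h : ∀ i, A i j ≠ 0 → x i ≤ b) :
    growth K A x j ≤ Fintype.card ι * b + K * (Fintype.card ι * b) ^ K := by
  have key : ∀ p : ι → Prop, ∀ _ : DecidablePred p, (∀ i, p i → A i j ≠ 0) →
      ∑ i with p i, x i ≤ Fintype.card ι * b := fun p _ hp => by
    calc ∑ i with p i, x i ≤ ∑ i with p i, b :=
          Finset.sum_le_sum fun i hi => h i (hp i (Finset.mem_filter.1 hi).2)
      _ ≤ Fintype.card ι * b := by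
          rw [Finset.sum_const, smul_eq_mul]
          exact Nat.mul_le_mul (Finset.card_le_univ _) le_rfl
  exact add_le_add (key _ _ fun i hi => by omega)
    (Nat.mul_le_mul le_rfl (Nat.pow_le_pow_left (key _ _ fun i hi => by omega) K))

variable [DecidableEq ι]

/-- The product `A s * A (s + 1) * ⋯ * A (t - 1)`. -/
def seg (A : ℕ → Matrix ι ι ℕ) (s : ℕ) : ℕ → Matrix ι ι ℕ
  | 0 => 1
  -- Segments that end at or before their start are the identity.
  | t + 1 => if s ≤ t then seg A s t * A t else 1

theorem seg_succ (A : ℕ → Matrix ι ι ℕ) {s t : ℕ} (h : s ≤ t) :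
    seg A s (t + 1) = seg A s t * A t := if_pos h

theorem seg_self (A : ℕ → Matrix ι ι ℕ) (s : ℕ) : seg A s s = 1 := by
  rcases s with _ | s
  · rfl
  · exact if_neg (by omega)

theorem seg_one (A : ℕ → Matrix ι ι ℕ) (s : ℕ) : seg A s (s + 1) = A s := by
  rw [seg_succ A le_rfl, seg_self, one_mul]

theorem seg_mul_seg (A : ℕ → Matrix ι ι ℕ) {s t u : ℕ} (hst : s ≤ t) (htu : t ≤ u) :
    seg A s t * seg A t u = seg A s u := by
  induction u, htu using Nat.le_induction with
  | base => rw [seg_self, mul_one]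
  | succ u htu ih => rw [seg_succ A htu, seg_succ A (hst.trans htu), ← ih, mul_assoc]

theorem mul_seg (A : ℕ → Matrix ι ι ℕ) {s t : ℕ} (h : s + 1 ≤ t) :
    A s * seg A (s + 1) t = seg A s t := by
  rw [← seg_mul_seg A (Nat.le_succ s) h, Nat.succ_eq_add_one, seg_one]

end Matrices

/-! ### Growth along sequences of matrices without certain cycles -/

section Growth

variable {ι : Type*} [Fintype ι] [DecidableEq ι]

/-- Iterated bounds, one for each change of rank along a path. -/
def rankBound (a K Z : ℕ) : ℕ → ℕ
  | 0 => Z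
  | r + 1 => rankBound a K Z r + (a * rankBound a K Z r + K * (a * rankBound a K Z r) ^ K)

theorem rankBound_mono (a K Z : ℕ) : Monotone (rankBound a K Z) :=
  monotone_nat_of_le_succ fun _ => Nat.le_add_right _ _

theorem monoBdd_rankBound (a K r : ℕ) : MonoBdd fun Z => rankBound a K Z r := by
  induction r with
  | zero => exact monoBdd_id
  | succ r ih => exact ih.add ((ih.const_mul a).add ((ih.const_mul a).monomial K))

/-- If no tag `(lab s, k)` recurs along a path through a column that is wide, that is, has an
entry at least `2` in row `c`, then the growth is bounded independently of the length. -/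
theorem exists_le_of_no_wide_cycle (Λ : Type*) [Fintype Λ] (c : ι) (K : ℕ) :
    ∃ K', ∀ (T : ℕ) (A : ℕ → Matrix ι ι ℕ) (lab : ℕ → Λ) (e : ℕ → ι → ℕ) (j : ι) (Z : ℕ),
      (∀ t < T, ∀ k, A t c k < 2 → ∀ i i', A t i k ≠ 0 → A t i' k ≠ 0 → i = i' ∧ A t i k = 1) →
      (∀ s t k, s < t → t ≤ T → lab s = lab t → seg A t T k j ≠ 0 → seg A s t k k ≠ 0 →
        seg A s t c k < 2) →
      (∀ k, seg A 0 T k j ≠ 0 → e 0 k ≤ Z) →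
      (∀ t < T, ∀ k, seg A (t + 1) T k j ≠ 0 → e (t + 1) k ≤ growth K (A t) (e t) k) →
      e T j ≤ K' * Z ^ K' := by
  classical
  obtain ⟨K', hK'⟩ := monoBdd_rankBound (Fintype.card ι) K (Fintype.card (Λ × ι))
  refine ⟨K', fun T A lab e j Z hnarrow hcyc h0 hstep => le_trans ?_ (hK' Z)⟩
  -- The rank of a node `(t, k)` is the number of tags from which it is reached along a segment
  -- whose column at `k` is wide. It never decreases along a path.
  let V : ℕ → ι → Finset (Λ × ι) := fun t k =>
    univ.filter fun p => ∃ s < t, lab s = p.1 ∧ seg A s t p.2 k ≠ 0 ∧ 2 ≤ seg A s t c k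
  have hV : ∀ t k p, p ∈ V t k ↔ ∃ s < t, lab s = p.1 ∧ seg A s t p.2 k ≠ 0 ∧ 2 ≤ seg A s t c k :=
    fun t k p => by simp [V]
  have hVsub : ∀ t k k', A t k' k ≠ 0 → V t k' ⊆ V (t + 1) k := by
    intro t k k' hk p hp
    obtain ⟨s, hs, h1, h2, h3⟩ := (hV _ _ _).1 hp
    refine (hV _ _ _).2 ⟨s, by omega, h1, ?_, ?_⟩ <;> rw [seg_succ A hs.le]
    · exact entry_mul_ne_zero h2 hk
    · exact two_le_entry_mul_left h3 hk
  have hpred : ∀ t < T, ∀ k k', seg A (t + 1) T k j ≠ 0 → A t k' k ≠ 0 → seg A t T k' j ≠ 0 := by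
    intro t ht k k' hk hk'
    rw [← mul_seg A (Nat.succ_le_of_lt ht)]
    exact entry_mul_ne_zero hk' hk
  have key : ∀ t ≤ T, ∀ k, seg A t T k j ≠ 0 →
      e t k ≤ rankBound (Fintype.card ι) K Z (V t k).card := by
    intro t
    induction t with
    | zero =>
      intro _ k hk
      exact (h0 k hk).trans (rankBound_mono _ _ _ (Nat.zero_le _))
    | succ t ih =>
      intro ht k hk
      have ht' : t < T := ht
      refine (hstep t ht' k hk).trans ?_
      by_cases hw : 2 ≤ A t c k
      · by_cases hz : ∃ k', A t k' k ≠ 0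
        · obtain ⟨k₀, hk₀⟩ := hz
          -- A wide step adds the tag `(lab t, k')` of the predecessor. Were it present already,
          -- `k'` would lie on a wide cycle.
          have hlt : ∀ k', A t k' k ≠ 0 → (V t k').card < (V (t + 1) k).card := by
            intro k' hk'
            refine Finset.card_lt_card (Finset.ssubset_iff_of_subset (hVsub t k k' hk') |>.2
              ⟨(lab t, k'), (hV _ _ _).2 ⟨t, by omega, rfl, ?_, ?_⟩, fun hmem => ?_⟩)
            · rwa [seg_one]
            · rwa [seg_one]
            · obtain ⟨s, hs, h1, h2, h3⟩ := (hV _ _ _).1 hmem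
              have := hcyc s t k' hs ht'.le h1 (hpred t ht' k k' hk hk') h2
              omega
          obtain ⟨r, hr⟩ : ∃ r, (V (t + 1) k).card = r + 1 :=
            ⟨_, (Nat.succ_pred_eq_of_pos ((Nat.zero_le _).trans_lt (hlt k₀ hk₀))).symm⟩
          rw [hr]
          refine (growth_le_of_le (b := rankBound (Fintype.card ι) K Z r) fun k' hk' => ?_).trans
            (Nat.le_add_left _ _)
          refine (ih ht'.le k' (hpred t ht' k k' hk hk')).trans (rankBound_mono _ _ _ ?_)
          have := hlt k' hk'
          omega
        · push Not at hz
          simp [growth, hz, zero_mul_pow]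
      · by_cases hz : ∃ k', A t k' k ≠ 0
        · obtain ⟨k₀, hk₀⟩ := hz
          -- A narrow column has a single entry, equal to 1, so the value is copied from `k₀` and
          -- the rank does not drop.
          have hn := hnarrow t ht' k (by omega)
          have e1 : univ.filter (fun i => A t i k = 1) = {k₀} := by
            ext i
            simp only [mem_filter, mem_univ, true_and, mem_singleton]
            constructor
            · intro hi
              exact (hn i k₀ (by omega) hk₀).1
            · rintro rfl
              exact (hn i i hk₀ hk₀).2
          have e2 : univ.filter (fun i => 2 ≤ A t i k) = ∅ := by
            ext i
            simp only [mem_filter, mem_univ, true_and, notMem_empty, iff_false]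
            intro hi
            have := (hn i i (by omega) (by omega)).2
            omega
          rw [growth, e1, e2, sum_singleton, sum_empty, zero_mul_pow, add_zero]
          exact (ih ht'.le k₀ (hpred t ht' k k₀ hk hk₀)).trans
            (rankBound_mono _ _ _ (Finset.card_le_card (hVsub t k k₀ hk₀)))
        · push Not at hz
          simp [growth, hz, zero_mul_pow]
  exact (key T le_rfl j (by rw [seg_self]; simp)).trans
    (rankBound_mono _ _ _ (Finset.card_le_univ _))

/-- Iterated bounds for paths whose number grows linearly with their length: `(Y * a)` bounds the
number of starting points of paths within one rank. -/
def linRankBound (a K Y : ℕ) : ℕ → ℕ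
  | 0 => Y
  | r + 1 => linRankBound a K Y r * (Y * a) +
      (a * (linRankBound a K Y r * (Y * a)) + K * (a * (linRankBound a K Y r * (Y * a))) ^ K)

theorem monoBdd_linRankBound (a K r : ℕ) : MonoBdd fun Y => linRankBound a K Y r := by
  have aux : ∀ {f : ℕ → ℕ}, MonoBdd f → MonoBdd fun Y => f Y * (Y * a) := fun hf =>
    (hf.mul (monoBdd_id.const_mul a)).mono fun Z => by rw [mul_comm a Z]
  induction r with
  | zero => exact monoBdd_id
  | succ r ih =>
    exact (aux ih).add (((aux ih).const_mul a).add (((aux ih).const_mul a).monomial K))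

theorem linRankBound_mono {a Y : ℕ} (K : ℕ) (h : 1 ≤ Y * a) : Monotone (linRankBound a K Y) :=
  monotone_nat_of_le_succ fun _ => (Nat.le_mul_of_pos_right _ h).trans (Nat.le_add_right _ _)

/-- If no tag `(lab s, k)` recurs along a path with an entry at least `2`, then the growth is
polynomial in the length. -/
theorem exists_le_of_no_double_cycle (Λ : Type*) [Fintype Λ] (K : ℕ) :
    ∃ K', ∀ (T : ℕ) (A : ℕ → Matrix ι ι ℕ) (lab : ℕ → Λ) (e : ℕ → ι → ℕ) (j : ι) (Z : ℕ),
      (∀ s t k, s < t → t ≤ T → lab s = lab t → seg A t T k j ≠ 0 → seg A s t k k < 2) →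
      (∀ k, seg A 0 T k j ≠ 0 → e 0 k ≤ Z) →
      (∀ t < T, ∀ k, seg A (t + 1) T k j ≠ 0 → e (t + 1) k ≤ growth K (A t) (e t) k) →
      e T j ≤ K' * (T + 1 + Z) ^ K' := by
  classical
  obtain ⟨K', hK'⟩ := ((monoBdd_linRankBound (Fintype.card ι) K (Fintype.card (Λ × ι))).mul
    (monoBdd_id.const_mul (Fintype.card ι)))
  refine ⟨K', fun T A lab e j Z hcyc h0 hstep => le_trans ?_ (hK' (T + 1 + Z))⟩
  set Y := T + 1 + Z with hY
  set a := Fintype.card ι with ha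
  have hYa : 1 ≤ Y * a := Nat.mul_pos (by omega) (Fintype.card_pos_iff.2 ⟨j⟩)
  -- The rank now counts the tags joined to `(t, k)` by an entry at least 2. By `hSlt` it increases
  -- strictly along every such segment that can be continued to `j`, since a repeated tag would
  -- close a double cycle.
  let S : ℕ → ι → Finset (Λ × ι) := fun t k =>
    univ.filter fun p => ∃ s < t, lab s = p.1 ∧ 2 ≤ seg A s t p.2 k
  have hS : ∀ t k p, p ∈ S t k ↔ ∃ s < t, lab s = p.1 ∧ 2 ≤ seg A s t p.2 k :=
    fun t k p => by simp [S]
  have hSsub : ∀ t k k', A t k' k ≠ 0 → S t k' ⊆ S (t + 1) k := by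
    intro t k k' hk p hp
    obtain ⟨s, hs, h1, h2⟩ := (hS _ _ _).1 hp
    refine (hS _ _ _).2 ⟨s, by omega, h1, ?_⟩
    rw [seg_succ A hs.le]
    exact two_le_entry_mul_left h2 hk
  have hpred : ∀ t < T, ∀ k k', seg A (t + 1) T k j ≠ 0 → A t k' k ≠ 0 → seg A t T k' j ≠ 0 := by
    intro t ht k k' hk hk'
    rw [← mul_seg A (Nat.succ_le_of_lt ht)]
    exact entry_mul_ne_zero hk' hk
  have hSsub' : ∀ s t, s ≤ t → ∀ k k', seg A s t k' k ≠ 0 → S s k' ⊆ S t k := by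
    intro s t hst k k' hk p hp
    obtain ⟨s', hs', h1, h2⟩ := (hS _ _ _).1 hp
    refine (hS _ _ _).2 ⟨s', by omega, h1, ?_⟩
    rw [← seg_mul_seg A hs'.le hst]
    exact two_le_entry_mul_left h2 hk
  have hSlt : ∀ s t, s < t → t ≤ T → ∀ k k', seg A t T k j ≠ 0 → 2 ≤ seg A s t k' k →
      (S s k').card < (S t k).card := by
    intro s t hst ht k k' hk hk'
    refine Finset.card_lt_card (Finset.ssubset_iff_of_subset (hSsub' s t hst.le k k' (by omega))
      |>.2 ⟨(lab s, k'), (hS _ _ _).2 ⟨s, hst, rfl, hk'⟩, fun hmem => ?_⟩)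
    obtain ⟨s', hs', h1, h2⟩ := (hS _ _ _).1 hmem
    change 2 ≤ seg A s' s k' k' at h2
    have := hcyc s' s k' hs' (by omega) h1 (by
      rw [← seg_mul_seg A hst.le ht]
      exact entry_mul_ne_zero (by omega) hk)
    omega
  -- Nodes of the same rank joined to `(t, k)` by exactly one path. Each stands for one inflow of
  -- values of lower rank (or an initial value), and there are at most `(T + 1) * a` of them.
  let N : ℕ → ι → Finset (ℕ × ι) := fun t k => (range (t + 1) ×ˢ univ).filter fun p =>
    seg A p.1 t p.2 k = 1 ∧ (S p.1 p.2).card = (S t k).card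
  have hN : ∀ t k p, p ∈ N t k ↔
      p.1 ≤ t ∧ seg A p.1 t p.2 k = 1 ∧ (S p.1 p.2).card = (S t k).card :=
    fun t k p => by simp [N]
  have hNself : ∀ t k, (t, k) ∈ N t k := fun t k =>
    (hN _ _ _).2 ⟨le_rfl, by rw [seg_self]; simp, rfl⟩
  have hNcard : ∀ t ≤ T, ∀ k, (N t k).card ≤ Y * a := by
    intro t ht k
    refine (Finset.card_le_card (Finset.filter_subset _ _)).trans ?_
    rw [card_product, card_range, card_univ]
    exact Nat.mul_le_mul (by omega) le_rfl
  have key : ∀ t ≤ T, ∀ k, seg A t T k j ≠ 0 →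
      e t k ≤ linRankBound a K Y (S t k).card * (N t k).card := by
    intro t
    induction t with
    | zero =>
      intro _ k hk
      have : 0 < (N 0 k).card := Finset.card_pos.2 ⟨_, hNself 0 k⟩
      calc e 0 k ≤ Y := (h0 k hk).trans (by omega)
        _ ≤ linRankBound a K Y (S 0 k).card := linRankBound_mono K hYa (Nat.zero_le _)
        _ ≤ _ := Nat.le_mul_of_pos_right _ this
    | succ t ih =>
      intro ht k hk
      have ht' : t < T := ht
      refine (hstep t ht' k hk).trans ?_
      set r := (S (t + 1) k).card with hr
      have ihle : ∀ k', A t k' k ≠ 0 → e t k' ≤ linRankBound a K Y (S t k').card * (N t k').card :=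
        fun k' hk' => ih ht'.le k' (hpred t ht' k k' hk hk')
      have hcard_le : ∀ k', A t k' k ≠ 0 → (S t k').card ≤ r := fun k' hk' =>
        Finset.card_le_card (hSsub t k k' hk')
      have hcard_lt : ∀ k', 2 ≤ A t k' k → (S t k').card < r := fun k' hk' =>
        hSlt t (t + 1) (by omega) ht k k' hk (by rwa [seg_one])
      have hsplit : ∑ i with A t i k = 1, e t i =
          ∑ i with A t i k = 1 ∧ (S t i).card = r, e t i +
          ∑ i with A t i k = 1 ∧ (S t i).card ≠ r, e t i := by
        rw [← Finset.sum_filter_add_sum_filter_not _ (fun i => (S t i).card = r),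
          Finset.filter_filter, Finset.filter_filter]
      -- summands of the same rank
      have hsame : ∑ i with A t i k = 1 ∧ (S t i).card = r, e t i + linRankBound a K Y r ≤
          linRankBound a K Y r * (N (t + 1) k).card := by
        -- A starting point shared by two predecessors would have two paths to `k`, which would
        -- raise the rank.
        have hdisj : Set.PairwiseDisjoint
            (↑(univ.filter fun i => A t i k = 1 ∧ (S t i).card = r) : Set ι) (N t) := by
          intro i hi i' hi' hne
          rw [Function.onFun, Finset.disjoint_left]
          rintro ⟨s, m⟩ h1 h2
          simp only [coe_filter, mem_univ, true_and, Set.mem_ofPred_eq] at hi hi'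
          obtain ⟨hs, g1, g2⟩ := (hN _ _ _).1 h1
          obtain ⟨-, g3, -⟩ := (hN _ _ _).1 h2
          have h22 : 2 ≤ seg A s (t + 1) m k := by
            rw [seg_succ A hs]
            exact two_le_entry_mul_of_ne hne (by simp_all) (by omega) (by simp_all) (by omega)
          have := hSlt s (t + 1) (by simp at hs; omega) ht k m hk h22
          simp only at g2
          omega
        -- The new node `(t + 1, k)` pays for the summands of lower rank and for the products
        -- entering at this step, bounded in `hrest`.
        have hsub : insert (t + 1, k)
            ((univ.filter fun i => A t i k = 1 ∧ (S t i).card = r).biUnion (N t)) ⊆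
              N (t + 1) k := by
          intro p hp
          rcases Finset.mem_insert.1 hp with rfl | hp
          · exact hNself _ _
          obtain ⟨i, hi, hp⟩ := Finset.mem_biUnion.1 hp
          obtain ⟨-, hi, hi'⟩ := Finset.mem_filter.1 hi
          obtain ⟨h1, h2, h3⟩ := (hN _ _ _).1 hp
          refine (hN _ _ _).2 ⟨by omega, ?_, by omega⟩
          by_contra hne
          have hnz : seg A p.1 (t + 1) p.2 k ≠ 0 := by
            rw [seg_succ A h1]
            exact entry_mul_ne_zero (j := i) (by omega) (by omega)
          have := hSlt p.1 (t + 1) (by omega) ht k p.2 hk (by omega)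
          omega
        have hcard := Finset.card_le_card hsub
        rw [Finset.card_insert_of_notMem, Finset.card_biUnion hdisj] at hcard
        · calc _ ≤ ∑ i with A t i k = 1 ∧ (S t i).card = r,
                linRankBound a K Y r * (N t i).card + linRankBound a K Y r := by
                refine Nat.add_le_add_right (Finset.sum_le_sum fun i hi => ?_) _
                obtain ⟨-, hi, hi'⟩ := Finset.mem_filter.1 hi
                have := ihle i (by omega)
                rwa [hi'] at this
            _ = linRankBound a K Y r *
                (∑ i with A t i k = 1 ∧ (S t i).card = r, (N t i).card + 1) := by
                rw [mul_add, mul_one, Finset.mul_sum]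
            _ ≤ _ := Nat.mul_le_mul le_rfl hcard
        · intro hmem
          obtain ⟨i, -, hp⟩ := Finset.mem_biUnion.1 hmem
          have := ((hN _ _ _).1 hp).1
          simp at this
      -- summands of smaller rank and products
      have hrest : ∑ i with A t i k = 1 ∧ (S t i).card ≠ r, e t i +
          K * (∑ i with 2 ≤ A t i k, e t i) ^ K ≤ linRankBound a K Y r := by
        rcases hr0 : r with _ | r'
        · have e1 : univ.filter (fun i => A t i k = 1 ∧ (S t i).card ≠ 0) = ∅ := by
            ext i
            simp only [mem_filter, mem_univ, true_and, notMem_empty, iff_false]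
            rintro ⟨h1, h2⟩
            have := hcard_le i (by omega)
            omega
          have e2 : univ.filter (fun i => 2 ≤ A t i k) = ∅ := by
            ext i
            simp only [mem_filter, mem_univ, true_and, notMem_empty, iff_false]
            intro h1
            have := hcard_lt i h1
            omega
          rw [e1, e2]
          simp [zero_mul_pow]
        · have hb : ∀ k', A t k' k ≠ 0 → (S t k').card < r →
              e t k' ≤ linRankBound a K Y r' * (Y * a) := fun k' hk' hlt =>
            (ihle k' hk').trans (Nat.mul_le_mul (linRankBound_mono K hYa (by omega))
              (hNcard t ht'.le k'))
          have hsum : ∀ p : ι → Prop, ∀ _ : DecidablePred p,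
              (∀ i, p i → A t i k ≠ 0 ∧ (S t i).card < r) →
              ∑ i with p i, e t i ≤ a * (linRankBound a K Y r' * (Y * a)) := fun p _ hp => by
            calc ∑ i with p i, e t i ≤ ∑ i with p i, linRankBound a K Y r' * (Y * a) :=
                  Finset.sum_le_sum fun i hi =>
                    hb i (hp i (Finset.mem_filter.1 hi).2).1 (hp i (Finset.mem_filter.1 hi).2).2
              _ ≤ _ := by
                  rw [Finset.sum_const, smul_eq_mul]
                  exact Nat.mul_le_mul (Finset.card_le_univ _) le_rfl
          refine le_trans (add_le_add (hsum _ _ fun i hi => ?_) (Nat.mul_le_mul le_rfl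
            (Nat.pow_le_pow_left (hsum _ _ fun i hi => ?_) K))) (Nat.le_add_left _ _)
          · have := hcard_le i (by omega)
            exact ⟨by omega, by omega⟩
          · exact ⟨by omega, hcard_lt i hi⟩
      rw [growth, hsplit]
      omega
  calc e T j ≤ _ := key T le_rfl j (by rw [seg_self]; simp)
    _ ≤ linRankBound a K Y (S T j).card * (Y * a) := Nat.mul_le_mul le_rfl (hNcard T le_rfl j)
    _ ≤ linRankBound a K Y (Fintype.card (Λ × ι)) * (Y * a) :=
        Nat.mul_le_mul (linRankBound_mono K hYa (Finset.card_le_univ _)) le_rfl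
    _ = _ := by rw [mul_comm Y a]

/-- The share of the values along `A` that flows by single paths to the final node `j`. -/
def unitFlow (A : ℕ → Matrix ι ι ℕ) (T : ℕ) (j : ι) (x : ι → ℕ) (t : ℕ) (k : ι) : ℕ :=
  ∑ i with seg A 0 T i j = 1, seg A 0 t i k * x i

/-- A source reaching `k` would reach `j` with an entry at least 2, but the flow only counts sources
with total entry 1. -/
theorem unitFlow_zero_of_two_le {A : ℕ → Matrix ι ι ℕ} {T : ℕ} {j : ι} (x : ι → ℕ) {t : ℕ}
    (ht : t ≤ T) {k : ι} (h : 2 ≤ seg A t T k j) : unitFlow A T j x t k = 0 := by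
  refine Finset.sum_eq_zero fun i hi => ?_
  have hi := (Finset.mem_filter.1 hi).2
  by_contra hne
  rw [← seg_mul_seg A (Nat.zero_le t) ht] at hi
  have := two_le_entry_mul_right (left_ne_zero_of_mul hne) h
  omega

theorem excess_zero_le {A : ℕ → Matrix ι ι ℕ} {T : ℕ} {j : ι} (x : ι → ℕ) {k : ι}
    (hk : seg A 0 T k j ≠ 0) :
    x k - unitFlow A T j x 0 k ≤ ∑ i with 2 ≤ seg A 0 T i j, x i := by
  by_cases h : seg A 0 T k j = 1
  · have hmem : k ∈ univ.filter fun i => seg A 0 T i j = 1 := by simp [h]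
    have : x k ≤ unitFlow A T j x 0 k := by
      have := Finset.single_le_sum (f := fun i => seg A 0 0 i k * x i)
        (fun _ _ => Nat.zero_le _) hmem
      simpa [seg_self, unitFlow] using this
    omega
  · exact (Nat.sub_le _ _).trans (Finset.single_le_sum (fun _ _ => Nat.zero_le _)
      (Finset.mem_filter.2 ⟨mem_univ k, by omega⟩))

/-- Subtracting the unit flow preserves the growth inequality. The flow vanishes at arguments of the
monomial, and along unit entries the incoming flow is at most the flow at `k`. -/
theorem excess_step {A : ℕ → Matrix ι ι ℕ} {T : ℕ} {j : ι} {K : ℕ} {v : ℕ → ι → ℕ} {t : ℕ}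
    (ht : t < T) {k : ι} (hk : seg A (t + 1) T k j ≠ 0)
    (hv : v (t + 1) k ≤ growth K (A t) (v t) k) :
    v (t + 1) k - unitFlow A T j (v 0) (t + 1) k ≤
      growth K (A t) (fun i => v t i - unitFlow A T j (v 0) t i) k := by
  have h2 : ∑ i with 2 ≤ A t i k, v t i =
      ∑ i with 2 ≤ A t i k, (v t i - unitFlow A T j (v 0) t i) := by
    refine Finset.sum_congr rfl fun i hi => ?_
    rw [unitFlow_zero_of_two_le (v 0) ht.le, Nat.sub_zero]
    rw [← mul_seg A (Nat.succ_le_of_lt ht)]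
    exact two_le_entry_mul_left (Finset.mem_filter.1 hi).2 hk
  have h1 : ∑ i with A t i k = 1, v t i ≤ unitFlow A T j (v 0) (t + 1) k +
      ∑ i with A t i k = 1, (v t i - unitFlow A T j (v 0) t i) := by
    have hflow : ∑ i with A t i k = 1, unitFlow A T j (v 0) t i ≤
        unitFlow A T j (v 0) (t + 1) k := by
      calc ∑ i with A t i k = 1, unitFlow A T j (v 0) t i
          = ∑ i with A t i k = 1, A t i k * unitFlow A T j (v 0) t i :=
            Finset.sum_congr rfl fun i hi => by rw [(Finset.mem_filter.1 hi).2, one_mul]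
        _ ≤ ∑ i, A t i k * unitFlow A T j (v 0) t i :=
            Finset.sum_le_sum_of_subset (Finset.filter_subset _ _)
        _ = unitFlow A T j (v 0) (t + 1) k := by
            simp only [unitFlow, Finset.mul_sum]
            rw [Finset.sum_comm]
            refine Finset.sum_congr rfl fun m _ => ?_
            rw [seg_succ A (Nat.zero_le t), Matrix.mul_apply, Finset.sum_mul]
            exact Finset.sum_congr rfl fun i _ => by ring
    calc ∑ i with A t i k = 1, v t i ≤ ∑ i with A t i k = 1,
          (unitFlow A T j (v 0) t i + (v t i - unitFlow A T j (v 0) t i)) :=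
          Finset.sum_le_sum fun i _ => by omega
      _ ≤ _ := by
          rw [Finset.sum_add_distrib]
          exact Nat.add_le_add_right hflow _
  rw [growth] at hv ⊢
  rw [h2] at hv
  omega

theorem le_unit_add_excess (A : ℕ → Matrix ι ι ℕ) (T : ℕ) (j : ι) (v : ℕ → ι → ℕ) :
    v T j ≤ ∑ i with seg A 0 T i j = 1, v 0 i + (v T j - unitFlow A T j (v 0) T j) := by
  have : unitFlow A T j (v 0) T j = ∑ i with seg A 0 T i j = 1, v 0 i :=
    Finset.sum_congr rfl fun i hi => by rw [(Finset.mem_filter.1 hi).2, one_mul]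
  omega

/-- The crude bound is applied to the excess over the unit flow, whose initial values involve only
the rows with total entry at least 2. Thus the unit rows keep coefficient exactly 1, as needed for
iterating the bound. -/
theorem exists_growth_of_no_wide_cycle (Λ : Type*) [Fintype Λ] (c : ι) (K : ℕ) :
    ∃ K', ∀ (T : ℕ) (A : ℕ → Matrix ι ι ℕ) (lab : ℕ → Λ) (v : ℕ → ι → ℕ) (j : ι),
      (∀ t < T, ∀ k, A t c k < 2 → ∀ i i', A t i k ≠ 0 → A t i' k ≠ 0 → i = i' ∧ A t i k = 1) →
      (∀ s t k, s < t → t ≤ T → lab s = lab t → seg A t T k j ≠ 0 → seg A s t k k ≠ 0 →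
        seg A s t c k < 2) →
      (∀ t < T, ∀ k, seg A (t + 1) T k j ≠ 0 → v (t + 1) k ≤ growth K (A t) (v t) k) →
      v T j ≤ growth K' (seg A 0 T) (v 0) j := by
  obtain ⟨K', hK'⟩ := exists_le_of_no_wide_cycle Λ c K
  refine ⟨K', fun T A lab v j hn hc hs => (le_unit_add_excess A T j v).trans ?_⟩
  exact Nat.add_le_add_left (hK' T A lab (fun t k => v t k - unitFlow A T j (v 0) t k) j _ hn hc
    (fun k hk => excess_zero_le (v 0) hk) fun t ht k hk => excess_step ht hk (hs t ht k hk)) _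

theorem exists_growth_of_no_double_cycle (Λ : Type*) [Fintype Λ] (K : ℕ) :
    ∃ K', ∀ (T : ℕ) (A : ℕ → Matrix ι ι ℕ) (lab : ℕ → Λ) (v : ℕ → ι → ℕ) (j : ι),
      (∀ s t k, s < t → t ≤ T → lab s = lab t → seg A t T k j ≠ 0 → seg A s t k k < 2) →
      (∀ t < T, ∀ k, seg A (t + 1) T k j ≠ 0 → v (t + 1) k ≤ growth K (A t) (v t) k) →
      v T j ≤ ∑ i with seg A 0 T i j = 1, v 0 i +
        K' * (T + 1 + ∑ i with 2 ≤ seg A 0 T i j, v 0 i) ^ K' := by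
  obtain ⟨K', hK'⟩ := exists_le_of_no_double_cycle (ι := ι) Λ K
  refine ⟨K', fun T A lab v j hc hs => (le_unit_add_excess A T j v).trans ?_⟩
  exact Nat.add_le_add_left (hK' T A lab (fun t k => v t k - unitFlow A T j (v 0) t k) j _ hc
    (fun k hk => excess_zero_le (v 0) hk) fun t ht k hk => excess_step ht hk (hs t ht k hk)) _

end Growth

variable {n : ℕ}

/-! ### Dependence types -/

theorem DepType.one_sup (a : DepType) : DepType.one ⊔ a = a :=
  max_eq_right (show DepType.rank _ ≤ DepType.rank _ by cases a <;> decide)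

theorem DepType.sup_one (a : DepType) : a ⊔ DepType.one = a := by
  rw [sup_comm, DepType.one_sup]

theorem DepType.two_sup {a : DepType} (h : a ≠ .three) : DepType.two ⊔ a = .two :=
  max_eq_left (show DepType.rank _ ≤ DepType.rank _ by cases a <;> first | decide | exact absurd rfl h)

theorem DepType.sup_two {a : DepType} (h : a ≠ .three) : a ⊔ DepType.two = .two := by
  rw [sup_comm, DepType.two_sup h]

theorem DepType.three_sup (a : DepType) : DepType.three ⊔ a = .three :=
  max_eq_left (show DepType.rank _ ≤ DepType.rank _ by cases a <;> decide)

theorem DepType.sup_three (a : DepType) : a ⊔ DepType.three = .three := by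
  rw [sup_comm, DepType.three_sup]

theorem DepType.IsUnit.onePlus_sup {a : DepType} (h : a.IsUnit) : DepType.onePlus ⊔ a = .onePlus :=
  max_eq_left (show DepType.rank _ ≤ DepType.rank _ by rcases h with rfl | rfl <;> decide)

theorem DepType.IsUnit.sup_onePlus {a : DepType} (h : a.IsUnit) :
    a ⊔ DepType.onePlus = .onePlus := by
  rw [sup_comm, h.onePlus_sup]

theorem DepType.IsUnit.ne_three {a : DepType} (h : a.IsUnit) : a ≠ .three := by
  rcases h with rfl | rfl <;> simp

/-! ### Sources of derivable dependences -/

/-- The sources of a dependence avoid the context `P`. -/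
def Dep.Avoids (P : Ctx n) : Dep n → Prop
  | .unary i _ _ => i ∉ P
  | .binary i i' _ _ => i ∉ P ∧ i' ∉ P

theorem Dep.Comp.avoids {P : Ctx n} {D D' E : Dep n} (h : Dep.Comp D D' E) (hD : D.Avoids P) :
    E.Avoids P := by
  cases h <;> simp_all [Dep.Avoids]

theorem Dep.CompSeq.avoids {P : Ctx n} {D : ℕ → Dep n} {m : ℕ} {E : Dep n}
    (h : Dep.CompSeq D m E) (hD : (D 0).Avoids P) : E.Avoids P := by
  induction h with
  | single => exact hD
  | snoc h hF ih => exact hF.avoids ih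

theorem Derives.avoids {C : Cmd n} {P Q : Ctx n} {D : Dep n} (h : Derives C P D Q) :
    D.Avoids P := by
  induction h with
  | skip hi => exact hi
  | zero hi => exact hi
  | var_other hi => exact hi
  | var_self hr => exact hr
  | mul_other hi => exact hi
  | mul_self hr hs ht => rcases ht with rfl | rfl <;> assumption
  | add_other _ hi => exact hi
  | add_left _ hr => exact hr
  | add_right _ _ hs => exact hs
  | add_both _ hr hs ht => rcases ht with rfl | rfl <;> assumption
  | atomic_binary _ hi hi' => exact ⟨hi, hi'⟩
  | choose_left _ ih => exact ih
  | choose_right _ ih => exact ih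
  | seq _ _ hD ih => exact hD.avoids ih
  | loop_zero _ ih => exact ih
  | loop_iter m P D hℓ h hE ih => exact hE.avoids (ih 0 (Nat.zero_le m))
  | loop_corr _ _ _ _ _ hE hF ih => exact hF.avoids (hE.avoids ih)

/-! ### Iterations of a loop body -/

/-- The dependences of a positive number of iterations of `C`. -/
inductive Iter (C : Cmd n) : Ctx n → Dep n → Ctx n → Prop
  | single {P Q : Ctx n} {D : Dep n} (h : Derives C P D Q) : Iter C P D Q
  | snoc {P Q R : Ctx n} {D D' E : Dep n} (h : Iter C P D Q) (h' : Derives C Q D' R)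
      (hE : Dep.Comp D D' E) : Iter C P E R

theorem Dep.CompSeq.congr {D D' : ℕ → Dep n} {m : ℕ} {E : Dep n} (h : Dep.CompSeq D m E)
    (hD : ∀ k ≤ m, D k = D' k) : Dep.CompSeq D' m E := by
  induction h with
  | single => rw [hD 0 le_rfl]; exact .single
  | snoc h hF ih =>
    rw [hD _ le_rfl] at hF
    exact .snoc (ih fun k hk => hD k (by omega)) hF

theorem Iter.exists_compSeq {C : Cmd n} {P Q : Ctx n} {E : Dep n} (h : Iter C P E Q) :
    ∃ (m : ℕ) (p : ℕ → Ctx n) (D : ℕ → Dep n), p 0 = P ∧ p (m + 1) = Q ∧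
      (∀ k ≤ m, Derives C (p k) (D k) (p (k + 1))) ∧ Dep.CompSeq D m E := by
  induction h with
  | @single Q D h =>
    refine ⟨0, fun k => if k = 0 then P else Q, fun _ => D, rfl, rfl, fun k hk => ?_, .single⟩
    obtain rfl : k = 0 := by omega
    exact h
  | @snoc Q R D D' E _ h' hE ih =>
    obtain ⟨m, p, d, h0, hm, hd, hc⟩ := ih
    refine ⟨m + 1, fun k => if k ≤ m + 1 then p k else R, fun k => if k ≤ m then d k else D',
      by simpa using h0, by simp, fun k hk => ?_, ?_⟩
    · rcases Nat.lt_or_eq_of_le hk with hk | rfl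
      · have h1 : k ≤ m := by omega
        have h2 : k ≤ m + 1 := by omega
        simpa [h1, h2] using hd k h1
      · simpa [hm] using h'
    · refine .snoc (hc.congr fun k hk => by simp [hk]) ?_
      simpa using hE

theorem Iter.loop {C : Cmd n} {P Q : Ctx n} {E : Dep n} {ℓ : Fin n} (hℓ : ℓ ∉ P)
    (h : Iter C P E Q) : Derives (.loop ℓ C) P E Q := by
  obtain ⟨m, p, D, rfl, rfl, hd, hc⟩ := h.exists_compSeq
  exact .loop_iter m p D hℓ hd hc

theorem Iter.avoids {C : Cmd n} {P Q : Ctx n} {E : Dep n} (h : Iter C P E Q) : E.Avoids P := by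
  induction h with
  | single h => exact h.avoids
  | snoc _ _ hE ih => exact hE.avoids ih

/-! ### Matrices of dependences

A matrix over `Option (Fin n)` describes a set of dependences that hold simultaneously; `none`
stands for a variable that constantly holds `1`. -/

/-- The matrices of dependences of the variables. -/
abbrev DepMatrix (n : ℕ) : Type := Matrix (Option (Fin n)) (Option (Fin n)) ℕ

/-- The dependences in the matrix `A` all satisfy `X` between the contexts `P` and `Q`: entries
`1` are of type `1`, or `1⁺` if the constant contributes to the column, larger entries are of
type `2`, and any two entries `1` form a binary dependence. -/
structure Valid (X : Ctx n → Dep n → Ctx n → Prop) (P Q : Ctx n) (A : DepMatrix n) : Prop where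
  many : ∀ i j, 2 ≤ A (some i) (some j) → X P (.unary i .two j) Q
  wide : ∀ i j, A (some i) (some j) = 1 → 2 ≤ A none (some j) → X P (.unary i .onePlus j) Q
  narrow : ∀ i j, A (some i) (some j) = 1 → A none (some j) < 2 → X P (.unary i .one j) Q
  pair : ∀ i i' j j', A (some i) (some j) = 1 → A (some i') (some j') = 1 → i ≠ i' ∨ j ≠ j' →
    X P (.binary i i' j j') Q
  const : ∀ i, A i none = if i = none then 1 else 0
  unique : ∀ j, A none j < 2 → ∀ i i', A i j ≠ 0 → A i' j ≠ 0 → i = i' ∧ A i j = 1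
  nonzero : ∀ j, j ∉ Q → ∃ i, A (some i) (some j) ≠ 0

/-! ### Closure of valid dependence matrices under multiplication -/

namespace Valid

variable {X X₁ X₂ X₃ : Ctx n → Dep n → Ctx n → Prop} {P Q R : Ctx n} {A B : DepMatrix n}

theorem mono (h : Valid X₁ P Q A) (hX : ∀ D, X₁ P D Q → X₂ P D Q) : Valid X₂ P Q A :=
  ⟨fun i j h1 => hX _ (h.many i j h1), fun i j h1 h2 => hX _ (h.wide i j h1 h2),
    fun i j h1 h2 => hX _ (h.narrow i j h1 h2),
    fun i i' j j' h1 h2 h3 => hX _ (h.pair i i' j j' h1 h2 h3), h.const, h.unique, h.nonzero⟩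

theorem exists_isUnit (h : Valid X P Q A) {i j : Fin n} (hA : A (some i) (some j) = 1) :
    ∃ α : DepType, α.IsUnit ∧ X P (.unary i α j) Q := by
  rcases Nat.lt_or_ge (A none (some j)) 2 with h1 | h1
  · exact ⟨_, .inl rfl, h.narrow i j hA h1⟩
  · exact ⟨_, .inr rfl, h.wide i j hA h1⟩

theorem exists_unary (h : Valid X P Q A) {i j : Fin n} (hA : A (some i) (some j) ≠ 0) :
    ∃ α : DepType, α ≠ .three ∧ X P (.unary i α j) Q := by
  by_cases h1 : A (some i) (some j) = 1
  · obtain ⟨α, hα, hX⟩ := h.exists_isUnit h1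
    exact ⟨α, hα.ne_three, hX⟩
  · exact ⟨_, by simp, h.many i j (by omega)⟩

theorem ne_none (h : Valid X P Q A) {i : Fin n} {j : Option (Fin n)} (hA : A (some i) j ≠ 0) :
    ∃ j', j = some j' := by
  rcases j with _ | j
  · exact absurd (by simpa using h.const (some i)) hA
  · exact ⟨j, rfl⟩

/-- The constant reaches itself with entry 1, so a wide column in either factor that leads to `k`
makes column `k` of the product wide. -/
theorem const_of_mul (hA : Valid X P Q A) {k : Option (Fin n)} (h : (A * B) none k < 2) :
    B none k < 2 ∧ ∀ j, B j k ≠ 0 → A none j < 2 := by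
  have h1 := hA.const none
  rw [if_pos rfl] at h1
  refine ⟨?_, fun j hj => ?_⟩
  · by_contra! hc
    have := two_le_entry_mul_right (A := A) (i := none) (j := none) (by omega) hc
    omega
  · by_contra! hc
    have := two_le_entry_mul_left hc hj
    omega

/-- Each way in which a product entry arises is matched by one composition rule. Two unit paths from
`i` to `k` through different variables give type 2 by the last rule for binary dependences. -/
theorem mul (hX : ∀ {P Q R : Ctx n} {D D' E : Dep n}, X₁ P D Q → X₂ Q D' R → Dep.Comp D D' E →
      X₃ P E R) (hX₂ : ∀ {D : Dep n}, X₂ Q D R → D.Avoids Q)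
    (hA : Valid X₁ P Q A) (hB : Valid X₂ Q R B) : Valid X₃ P R (A * B) where
  many i k h := by
    rcases of_two_le_entry_mul h with ⟨j, h1, h2, h3⟩ | ⟨j, j', hne, h1, h2, h3, h4⟩
    · obtain ⟨j, rfl⟩ := hA.ne_none h1
      rcases h3 with h3 | h3
      · obtain ⟨α, hα, hα'⟩ := hB.exists_unary h2
        have := hX (hA.many i j h3) hα' (.unary_unary _ _ _ _ _)
        rwa [DepType.two_sup hα] at this
      · obtain ⟨α, hα, hα'⟩ := hA.exists_unary h1
        have := hX hα' (hB.many j k h3) (.unary_unary _ _ _ _ _)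
        rwa [DepType.sup_two hα] at this
    · obtain ⟨j, rfl⟩ := hA.ne_none (by omega : A (some i) j ≠ 0)
      obtain ⟨j', rfl⟩ := hA.ne_none (by omega : A (some i) j' ≠ 0)
      have hne : j ≠ j' := fun h => hne (by rw [h])
      exact hX (hA.pair i i j j' h1 h3 (.inr hne)) (hB.pair j j' k k h2 h4 (.inl hne))
        (.binary_binary_eq _ _ _ _)
  wide i k h hw := by
    obtain ⟨j, h1, h2⟩ := of_entry_mul_eq_one h
    obtain ⟨j, rfl⟩ := hA.ne_none (by omega : A (some i) j ≠ 0)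
    obtain ⟨α, hα, hα'⟩ := hA.exists_isUnit h1
    rcases Nat.lt_or_ge (B none (some k)) 2 with hk | hk
    · have hn := hB.narrow j k h2 hk
      obtain ⟨m, hm, hm'⟩ := exists_of_entry_mul_ne_zero (A := A) (B := B) (i := none)
        (k := some k) (by omega)
      obtain ⟨rfl, -⟩ := hB.unique _ hk m (some j) hm' (by omega)
      -- The only entry of the narrow column `k` of `B` is in row `j`, so the constant reaches `k`
      -- through `j` too. A narrow column `j` of `A` could not contain both the constant and `i`.
      have hwA : 2 ≤ A none (some j) := by
        by_contra hc
        have := (hA.unique _ (by omega) none (some i) hm (by omega)).1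
        simp at this
      have := hX (hA.wide i j h1 hwA) hn (.unary_unary _ _ _ _ _)
      rwa [DepType.sup_one] at this
    · have := hX hα' (hB.wide j k h2 hk) (.unary_unary _ _ _ _ _)
      rwa [hα.sup_onePlus] at this
  narrow i k h hw := by
    obtain ⟨j, h1, h2⟩ := of_entry_mul_eq_one h
    obtain ⟨j, rfl⟩ := hA.ne_none (by omega : A (some i) j ≠ 0)
    obtain ⟨hk, hj⟩ := hA.const_of_mul hw
    have := hX (hA.narrow i j h1 (hj _ (by omega))) (hB.narrow j k h2 hk) (.unary_unary _ _ _ _ _)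
    rwa [DepType.sup_one] at this
  pair i i' k k' h h' hne := by
    obtain ⟨j, h1, h2⟩ := of_entry_mul_eq_one h
    obtain ⟨j, rfl⟩ := hA.ne_none (by omega : A (some i) j ≠ 0)
    obtain ⟨j', h3, h4⟩ := of_entry_mul_eq_one h'
    obtain ⟨j', rfl⟩ := hA.ne_none (by omega : A (some i') j' ≠ 0)
    -- The two unit paths may share their first step, share their last step, or differ in both. A
    -- shared step enters as a unary dependence.
    by_cases hi : i = i' ∧ j = j'
    · obtain ⟨rfl, rfl⟩ := hi
      obtain ⟨α, hα, hα'⟩ := hA.exists_isUnit h1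
      have hkk : k ≠ k' := by simpa using hne
      exact hX hα' (hB.pair j j k k' h2 h4 (.inr hkk)) (.unary_binary _ _ _ _ _ hα)
    · have hij : i ≠ i' ∨ j ≠ j' := by tauto
      by_cases hk : j = j' ∧ k = k'
      · obtain ⟨rfl, rfl⟩ := hk
        obtain ⟨α, hα, hα'⟩ := hB.exists_isUnit h2
        exact hX (hA.pair i i' j j h1 h3 hij) hα' (.binary_unary _ _ _ _ _ hα)
      · exact hX (hA.pair i i' j j' h1 h3 hij) (hB.pair j j' k k' h2 h4 (by tauto))
          (.binary_binary _ _ _ _ _ _ hne)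
  const i := by
    rw [Matrix.mul_apply, Finset.sum_eq_single none, hA.const, hB.const none]
    · simp
    · intro j _ hj
      rw [hB.const, if_neg hj, mul_zero]
    · simp
  unique k hk i i' h h' := by
    obtain ⟨hBk, hj⟩ := hA.const_of_mul hk
    obtain ⟨j, h1, h2⟩ := exists_of_entry_mul_ne_zero h
    obtain ⟨j', h3, h4⟩ := exists_of_entry_mul_ne_zero h'
    obtain ⟨rfl, hB1⟩ := hB.unique k hBk j j' h2 h4
    obtain ⟨rfl, hA1⟩ := hA.unique j (hj j h2) i i' h1 h3
    refine ⟨rfl, ?_⟩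
    rw [Matrix.mul_apply, Finset.sum_eq_single j, hA1, hB1]
    · intro m _ hm
      by_contra hc
      exact hm (hB.unique k hBk m j (right_ne_zero_of_mul hc) h2).1
    · simp
  nonzero k hk := by
    obtain ⟨j, hj⟩ := hB.nonzero k hk
    obtain ⟨α, -, hα⟩ := hB.exists_unary hj
    obtain ⟨i, hi⟩ := hA.nonzero j (hX₂ hα)
    exact ⟨i, entry_mul_ne_zero hi hj⟩

end Valid

/-! ### Upper bounds for commands -/

/-- The values of the variables, together with the constant `1`. -/
def Store.withOne (x : Store n) : Option (Fin n) → ℕ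
  | none => 1
  | some i => x i

/-- The matrix `A` of derivable dependences bounds the values in `y`, up to those that have a
dependence of type `3`, in terms of `x`. -/
structure Abstracts (C : Cmd n) (K : ℕ) (P Q : Ctx n) (A : DepMatrix n) (x y : Store n) :
    Prop where
  eq_zero : ∀ i ∈ Q, y i = 0
  valid : Valid (Derives C) P Q A
  notMem : ∀ v, ¬ C.Assigns v → v ∉ P → v ∉ Q
  column : ∀ v, ¬ C.Assigns v → v ∉ P → ∀ i, A i (some v) = if i = some v then 1 else 0
  le_growth : ∀ j, (∀ i, ¬ Derives C P (.unary i .three j) Q) →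
    y j ≤ growth K A x.withOne (some j)

theorem Abstracts.mono {C : Cmd n} {K K' : ℕ} {P Q : Ctx n} {A : DepMatrix n} {x y : Store n}
    (h : Abstracts C K P Q A x y) (hK : K ≤ K') : Abstracts C K' P Q A x y :=
  ⟨h.eq_zero, h.valid, h.notMem, h.column,
    fun j hj => (h.le_growth j hj).trans (growth_mono hK _ _ _)⟩

/-- Every run of `C` is bounded by a matrix of derivable dependences. -/
def Cmd.HasBound (C : Cmd n) (K : ℕ) : Prop :=
  ∀ (P : Ctx n) (x y : Store n), (∀ i ∈ P, x i = 0) → C.Rel .bounded x y →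
    ∃ Q A, Abstracts C K P Q A x y

theorem Cmd.HasBound.mono {C : Cmd n} {K K' : ℕ} (h : C.HasBound K) (hK : K ≤ K') :
    C.HasBound K' := fun P x y hx hr =>
  let ⟨Q, A, hA⟩ := h P x y hx hr
  ⟨Q, A, hA.mono hK⟩

theorem Valid.one_le_growth {X : Ctx n → Dep n → Ctx n → Prop} {P Q : Ctx n} {A : DepMatrix n}
    (h : Valid X P Q A) (K : ℕ) (x : Store n) : 1 ≤ growth K A x.withOne none := by
  have hmem : none ∈ univ.filter fun i => A i none = 1 := by simp [h.const]
  exact (Finset.single_le_sum (f := x.withOne) (fun _ _ => Nat.zero_le _) hmem).trans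
    (Nat.le_add_right _ _)

theorem le_growth_of_entry_eq_one {A : DepMatrix n} (K : ℕ) {x : Store n} {i : Fin n}
    {j : Option (Fin n)} (h : A (some i) j = 1) : x i ≤ growth K A x.withOne j := by
  have hmem : some i ∈ univ.filter fun i => A i j = 1 := by simp [h]
  exact (Finset.single_le_sum (f := x.withOne) (fun _ _ => Nat.zero_le _) hmem).trans
    (Nat.le_add_right _ _)

/-! #### Atomic commands -/

theorem Valid.of_isAtomic {C : Cmd n} {P Q : Ctx n} {A : DepMatrix n} (hC : C.IsAtomic)
    (many : ∀ i j, 2 ≤ A (some i) (some j) → Derives C P (.unary i .two j) Q)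
    (wide : ∀ i j, A (some i) (some j) = 1 → 2 ≤ A none (some j) →
      Derives C P (.unary i .onePlus j) Q)
    (narrow : ∀ i j, A (some i) (some j) = 1 → A none (some j) < 2 →
      Derives C P (.unary i .one j) Q)
    (const : ∀ i, A i none = if i = none then 1 else 0)
    (unique : ∀ j, A none j < 2 → ∀ i i', A i j ≠ 0 → A i' j ≠ 0 → i = i' ∧ A i j = 1)
    (nonzero : ∀ j, j ∉ Q ↔ ∃ i, A (some i) (some j) ≠ 0) : Valid (Derives C) P Q A where
  many := many
  wide := wide
  narrow := narrow
  pair i i' j j' h h' hne := by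
    have key : ∀ i j, A (some i) (some j) = 1 →
        ∃ α : DepType, α.IsUnit ∧ Derives C P (.unary i α j) Q := fun i j h => by
      rcases Nat.lt_or_ge (A none (some j)) 2 with h1 | h1
      · exact ⟨_, .inl rfl, narrow i j h h1⟩
      · exact ⟨_, .inr rfl, wide i j h h1⟩
    obtain ⟨α, hα, hd⟩ := key i j h
    obtain ⟨α', hα', hd'⟩ := key i' j' h'
    exact .atomic_binary hC hd.avoids hd'.avoids ((nonzero j).2 ⟨i, by omega⟩)
      ((nonzero j').2 ⟨i', by omega⟩) hne hα hα' hd hd'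
  const := const
  unique := unique
  nonzero j := (nonzero j).1

/-- The matrix with column `col` for the variable `l` and unit columns for the other variables
outside `P`. -/
def assignMatrix (P : Ctx n) (l : Fin n) (col : Option (Fin n) → ℕ) : DepMatrix n := fun i j =>
  if j = some l then col i else if i = j ∧ ∀ a ∈ P, j ≠ some a then 1 else 0

theorem assignMatrix_self (P : Ctx n) (l : Fin n) (col : Option (Fin n) → ℕ)
    (i : Option (Fin n)) : assignMatrix P l col i (some l) = col i := if_pos rfl

theorem assignMatrix_of_ne (P : Ctx n) {l : Fin n} (col : Option (Fin n) → ℕ)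
    (i : Option (Fin n)) {j : Option (Fin n)} (h : j ≠ some l) :
    assignMatrix P l col i j = if i = j ∧ ∀ a ∈ P, j ≠ some a then 1 else 0 := if_neg h

theorem abstracts_assign {l : Fin n} {e : Expr n} {P Q : Ctx n} {x : Store n}
    (K : ℕ) (col : Option (Fin n) → ℕ)
    (hother : ∀ i, i ∉ P → i ≠ l → Derives (.assign l e) P (.unary i .one i) Q)
    (hQ : ∀ i, i ≠ l → (i ∈ Q ↔ i ∈ P))
    (many : ∀ i, 2 ≤ col (some i) → Derives (.assign l e) P (.unary i .two l) Q)
    (wide : ∀ i, col (some i) = 1 → 2 ≤ col none → Derives (.assign l e) P (.unary i .onePlus l) Q)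
    (narrow : ∀ i, col (some i) = 1 → col none < 2 → Derives (.assign l e) P (.unary i .one l) Q)
    (unique : col none < 2 → ∀ i i', col i ≠ 0 → col i' ≠ 0 → i = i' ∧ col i = 1)
    (nonzero : l ∉ Q ↔ ∃ i, col (some i) ≠ 0)
    (hx : ∀ i ∈ P, x i = 0) (hzero : l ∈ Q → e.eval x = 0)
    (hval : e.eval x ≤ ∑ i with col i = 1, x.withOne i + K * (∑ i with 2 ≤ col i, x.withOne i) ^ K)
    {w : ℕ} (hw : w ≤ e.eval x) :
    Abstracts (.assign l e) K P Q (assignMatrix P l col) x (Function.update x l w) := by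
  refine ⟨fun i hi => ?_, Valid.of_isAtomic trivial ?_ ?_ ?_ ?_ ?_ ?_, fun v hv hP => ?_,
    fun v hv hP i => ?_, fun j _ => ?_⟩
  · by_cases h : i = l
    · subst h
      rw [Function.update_self]
      have := hzero hi
      omega
    · rw [Function.update_of_ne h]
      exact hx i ((hQ i h).1 hi)
  · intro i j h
    by_cases hj : j = l
    · subst hj
      rw [assignMatrix_self] at h
      exact many i h
    · rw [assignMatrix_of_ne P col _ (by simpa using hj)] at h
      split_ifs at h <;> omega
  · intro i j h h'
    by_cases hj : j = l
    · subst hj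
      rw [assignMatrix_self] at h h'
      exact wide i h h'
    · rw [assignMatrix_of_ne P col _ (by simpa using hj)] at h'
      split_ifs at h' <;> omega
  · intro i j h h'
    by_cases hj : j = l
    · subst hj
      rw [assignMatrix_self] at h h'
      exact narrow i h h'
    · rw [assignMatrix_of_ne P col _ (by simpa using hj)] at h
      split_ifs at h with hc
      · obtain ⟨h1, h2⟩ := hc
        obtain rfl : i = j := by simpa using h1
        exact hother i (fun hP => h2 i hP rfl) hj
  · intro i
    rw [assignMatrix_of_ne P col _ (by simp)]
    simp
  · intro j h i i' h1 h2
    by_cases hj : j = some l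
    · subst hj
      rw [assignMatrix_self] at h h1 h2 ⊢
      exact unique h i i' h1 h2
    · rw [assignMatrix_of_ne P col _ hj] at h1 h2 ⊢
      have h1 := (by simpa using h1 : i = j ∧ _)
      have h2 := (by simpa using h2 : i' = j ∧ _)
      refine ⟨h1.1.trans h2.1.symm, ?_⟩
      rw [if_pos]
      simpa using h1
  · intro j
    by_cases hj : j = l
    · subst hj
      simpa only [assignMatrix_self] using nonzero
    · rw [hQ j hj]
      constructor
      · intro h
        refine ⟨j, ?_⟩
        rw [assignMatrix_of_ne P col _ (by simpa using hj), if_pos]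
        · simp
        · exact ⟨rfl, fun a ha hja => h (by simp_all)⟩
      · rintro ⟨i, hi⟩ hP
        rw [assignMatrix_of_ne P col _ (by simpa using hj)] at hi
        simp at hi
        exact hi.2 hP
  · exact fun h => hP ((hQ v (Ne.symm hv)).1 h)
  · have hvl : v ≠ l := Ne.symm hv
    rw [assignMatrix_of_ne P col _ (by simpa using hvl)]
    refine if_congr (and_iff_left fun a ha hva => hP ?_) rfl rfl
    simp_all
  · by_cases hj : j = l
    · subst hj
      rw [Function.update_self]
      refine (hw.trans hval).trans (le_of_eq ?_)
      simp only [growth, assignMatrix_self]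
    · rw [Function.update_of_ne hj]
      by_cases hP : j ∈ P
      · rw [hx j hP]
        exact Nat.zero_le _
      · refine le_growth_of_entry_eq_one K ?_
        rw [assignMatrix_of_ne P col _ (by simpa using hj), if_pos]
        exact ⟨rfl, fun a ha hja => hP (by simp_all)⟩

theorem abstracts_assign_zero {l : Fin n} {e : Expr n} {P Q : Ctx n} {x : Store n} (K : ℕ)
    (hother : ∀ i, i ∉ P → i ≠ l → Derives (.assign l e) P (.unary i .one i) Q)
    (hQ : ∀ i, i ≠ l → (i ∈ Q ↔ i ∈ P)) (hl : l ∈ Q) (hx : ∀ i ∈ P, x i = 0)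
    (he : e.eval x = 0) {w : ℕ} (hw : w ≤ e.eval x) :
    ∃ A, Abstracts (.assign l e) K P Q A x (Function.update x l w) :=
  ⟨_, abstracts_assign K (fun _ => 0) hother hQ (by simp) (by simp) (by simp) (by simp)
    (by simpa using hl) hx (fun _ => he) (by simp [he]) hw⟩

theorem abstracts_assign_copy {l r : Fin n} {e : Expr n} {P Q : Ctx n} {x : Store n} (K : ℕ)
    (hother : ∀ i, i ∉ P → i ≠ l → Derives (.assign l e) P (.unary i .one i) Q)
    (hQ : ∀ i, i ≠ l → (i ∈ Q ↔ i ∈ P)) (hl : l ∉ Q) (hx : ∀ i ∈ P, x i = 0)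
    (hr : Derives (.assign l e) P (.unary r .one l) Q)
    (he : e.eval x = x r) {w : ℕ} (hw : w ≤ e.eval x) :
    ∃ A, Abstracts (.assign l e) K P Q A x (Function.update x l w) := by
  refine ⟨_, abstracts_assign K (fun i => if i = some r then 1 else 0) hother hQ ?_ ?_ ?_ ?_
    (by simpa using hl) hx (fun h => absurd h hl) ?_ hw⟩
  · intro i h
    split_ifs at h <;> omega
  · intro i _ h
    simp at h
  · intro i h _
    obtain rfl : i = r := by simpa using h
    exact hr
  · intro _ i i' h h'
    simp only [ne_eq, ite_eq_right_iff, one_ne_zero, imp_false, not_not] at h h'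
    simp [h, h']
  · have : univ.filter (fun i => (if i = some r then 1 else 0) = 1) = {some r} := by
      ext i
      simp
    rw [this, he, sum_singleton]
    exact Nat.le_add_right _ _

theorem Ctx.mem_set_of_ne {P : Ctx n} {l i : Fin n} {b : Prop} [Decidable b] (h : i ≠ l) :
    i ∈ P.set l b ↔ i ∈ P := by
  rw [Ctx.set]
  split_ifs <;> simp [h]

theorem Ctx.mem_set_self {P : Ctx n} {l : Fin n} {b : Prop} [Decidable b] :
    l ∈ P.set l b ↔ b := by
  rw [Ctx.set]
  split_ifs with h <;> simp [h]

theorem hasBound_assign (l : Fin n) (e : Expr n) (he : e.WellFormed) :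
    (Cmd.assign l e).HasBound 2 := by
  rintro P x y hx ⟨w, hw, rfl⟩
  change w ≤ e.eval x at hw
  cases e with
  | zero =>
    exact ⟨_, abstracts_assign_zero 2 (fun i => .zero) (fun i hi => by simp [hi]) (by simp) hx
      rfl hw⟩
  | var r =>
    refine ⟨P.set l (r ∈ P), ?_⟩
    by_cases hr : r ∈ P
    · exact abstracts_assign_zero 2 (fun i => .var_other) (fun i => Ctx.mem_set_of_ne)
        (Ctx.mem_set_self.2 hr) hx (hx r hr) hw
    · exact abstracts_assign_copy 2 (fun i => .var_other) (fun i => Ctx.mem_set_of_ne)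
        (fun h => hr (Ctx.mem_set_self.1 h)) hx (.var_self hr) rfl hw
  | mul r s =>
    refine ⟨P.set l (r ∈ P ∨ s ∈ P), ?_⟩
    by_cases hrs : r ∈ P ∨ s ∈ P
    · refine abstracts_assign_zero 2 (fun i => .mul_other) (fun i => Ctx.mem_set_of_ne)
        (Ctx.mem_set_self.2 hrs) hx ?_ hw
      rcases hrs with h | h <;> simp [Expr.eval, hx _ h]
    · have hl : l ∉ P.set l (r ∈ P ∨ s ∈ P) := fun h => hrs (Ctx.mem_set_self.1 h)
      have hr : r ∉ P := fun h => hrs (.inl h)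
      have hs : s ∉ P := fun h => hrs (.inr h)
      refine ⟨_, abstracts_assign 2
        -- The entry 2 for the constant makes the column wide, as its other entries are not those of
        -- a copy. This also covers `r = s`.
        (fun i => if i = none ∨ i = some r ∨ i = some s then 2 else 0) (fun i => .mul_other)
        (fun i => Ctx.mem_set_of_ne) ?_ ?_ ?_ ?_ ?_ hx (fun h => absurd h hl) ?_ hw⟩
      · intro i h
        by_cases hc : i = r ∨ i = s
        · exact .mul_self hr hs hc
        · simp [hc] at h
      · intro i h
        split_ifs at h <;> omega
      · intro i h
        split_ifs at h <;> omega
      · simp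
      · exact iff_of_true hl ⟨r, by simp⟩
      · have hsum : ∀ t, t = r ∨ t = s → x t ≤
            ∑ i with 2 ≤ (if i = none ∨ i = some r ∨ i = some s then 2 else 0),
              x.withOne i := fun t ht => by
          refine Finset.single_le_sum (f := x.withOne) (fun _ _ => Nat.zero_le _) (a := some t) ?_
          rcases ht with rfl | rfl <;> simp
        have := Nat.mul_le_mul (hsum r (.inl rfl)) (hsum s (.inr rfl))
        rw [← sq] at this
        refine le_trans ?_ (Nat.le_add_left _ _)
        change x r * x s ≤ _
        omega
  | add r s =>
    have hne : r ≠ s := he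
    refine ⟨P.set l (r ∈ P ∧ s ∈ P), ?_⟩
    by_cases hr : r ∈ P <;> by_cases hs : s ∈ P
    · refine abstracts_assign_zero 2 (fun i => .add_other hne) (fun i => Ctx.mem_set_of_ne)
        (Ctx.mem_set_self.2 ⟨hr, hs⟩) hx ?_ hw
      simp [Expr.eval, hx _ hr, hx _ hs]
    · exact abstracts_assign_copy 2 (fun i => .add_other hne) (fun i => Ctx.mem_set_of_ne)
        (fun h => hs (Ctx.mem_set_self.1 h).2) hx (.add_right hne hr hs)
        (by simp [Expr.eval, hx _ hr]) hw
    · exact abstracts_assign_copy 2 (fun i => .add_other hne) (fun i => Ctx.mem_set_of_ne)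
        (fun h => hr (Ctx.mem_set_self.1 h).1) hx (.add_left hne hr hs)
        (by simp [Expr.eval, hx _ hs]) hw
    · have hl : l ∉ P.set l (r ∈ P ∧ s ∈ P) := fun h => hr (Ctx.mem_set_self.1 h).1
      refine ⟨_, abstracts_assign 2
        -- Unit entries in a wide column encode type `1⁺`.
        (fun i => if i = none then 2 else if i = some r ∨ i = some s then 1 else 0)
        (fun i => .add_other hne) (fun i => Ctx.mem_set_of_ne) ?_ ?_ ?_ ?_ ?_ hx
        (fun h => absurd h hl) ?_ hw⟩
      · intro i h
        split_ifs at h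
        all_goals first | omega | contradiction
      · intro i h _
        by_cases hc : i = r ∨ i = s
        · exact .add_both hne hr hs hc
        · simp [hc] at h
      · intro i _ h
        simp at h
      · simp
      · exact iff_of_true hl ⟨r, by simp⟩
      · have : univ.filter (fun i : Option (Fin n) =>
            (if i = none then 2 else if i = some r ∨ i = some s then 1 else 0) = 1) =
            {some r, some s} := by
          ext i
          rcases i with _ | i <;> simp
          tauto
        rw [this, sum_pair (by simpa using hne)]
        exact Nat.le_add_right _ _

theorem abstracts_skip {P : Ctx n} {x : Store n} (hx : ∀ i ∈ P, x i = 0) (K : ℕ) :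
    ∃ A, Abstracts .skip K P P A x x := by
  have hA : ∀ i j : Option (Fin n),
      ((if i = j ∧ ∀ a ∈ P, j ≠ some a then 1 else 0 : ℕ) ≠ 0) → i = j ∧ ∀ a ∈ P, j ≠ some a :=
    fun i j h => by simpa using h
  refine ⟨fun i j => if i = j ∧ ∀ a ∈ P, j ≠ some a then 1 else 0, hx,
    Valid.of_isAtomic trivial ?_ ?_ ?_ ?_ ?_ ?_, fun _ _ h => h, fun v _ hP i => ?_,
    fun j _ => ?_⟩
  · intro i j h
    split_ifs at h <;> omega
  · intro i j _ h
    split_ifs at h <;> omega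
  · intro i j h _
    obtain ⟨h1, h2⟩ := hA _ _ (h.trans_ne one_ne_zero)
    obtain rfl : i = j := by simpa using h1
    exact .skip fun hP => h2 i hP rfl
  · simp
  · intro j _ i i' h h'
    exact ⟨(hA _ _ h).1.trans (hA _ _ h').1.symm, if_pos (hA _ _ h)⟩
  · intro j
    constructor
    · exact fun h => ⟨j, by simpa using h⟩
    · rintro ⟨i, hi⟩ hP
      exact (hA _ _ hi).2 j hP rfl
  · refine if_congr (and_iff_left fun a ha hva => hP ?_) rfl rfl
    simp_all
  · by_cases hP : j ∈ P
    · rw [hx j hP]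
      exact Nat.zero_le _
    · exact le_growth_of_entry_eq_one K (if_pos ⟨rfl, fun a ha hja => hP (by simp_all)⟩)

/-! #### Sequences and choices -/

theorem Abstracts.choose_left {C₁ : Cmd n} (C₂ : Cmd n) {K : ℕ} {P Q : Ctx n} {A : DepMatrix n}
    {x y : Store n} (h : Abstracts C₁ K P Q A x y) : Abstracts (.choose C₁ C₂) K P Q A x y :=
  ⟨h.eq_zero, h.valid.mono fun _ => .choose_left,
    fun v hv => h.notMem v fun h' => hv (.inl h'), fun v hv => h.column v fun h' => hv (.inl h'),
    fun j hj => h.le_growth j fun i hi => hj i (.choose_left hi)⟩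

theorem Abstracts.choose_right (C₁ : Cmd n) {C₂ : Cmd n} {K : ℕ} {P Q : Ctx n} {A : DepMatrix n}
    {x y : Store n} (h : Abstracts C₂ K P Q A x y) : Abstracts (.choose C₁ C₂) K P Q A x y :=
  ⟨h.eq_zero, h.valid.mono fun _ => .choose_right,
    fun v hv => h.notMem v fun h' => hv (.inr h'), fun v hv => h.column v fun h' => hv (.inr h'),
    fun j hj => h.le_growth j fun i hi => hj i (.choose_right hi)⟩

theorem column_mul {A B : DepMatrix n} {v : Option (Fin n)}
    (hA : ∀ i, A i v = if i = v then 1 else 0) (hB : ∀ i, B i v = if i = v then 1 else 0)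
    (i : Option (Fin n)) : (A * B) i v = if i = v then 1 else 0 := by
  rw [Matrix.mul_apply, Finset.sum_eq_single v]
  · rw [hA, hB, if_pos rfl, mul_one]
  · intro j _ hj
    rw [hB, if_neg hj, mul_zero]
  · simp

/-- A sequence is a path of two steps. Giving its three times different labels excludes cycles
altogether. -/
theorem hasBound_seq (n K : ℕ) : ∃ K', ∀ C₁ C₂ : Cmd n, C₁.HasBound K → C₂.HasBound K →
    (Cmd.seq C₁ C₂).HasBound K' := by
  obtain ⟨K', hK'⟩ := exists_growth_of_no_wide_cycle (Fin 3) (none : Option (Fin n)) K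
  refine ⟨K', fun C₁ C₂ h₁ h₂ => ?_⟩
  rintro P x y hx ⟨z, hxz, hzy⟩
  obtain ⟨Q, A, hA⟩ := h₁ P x z hx hxz
  obtain ⟨R, B, hB⟩ := h₂ Q z y hA.eq_zero hzy
  refine ⟨R, A * B, hB.eq_zero, hA.valid.mul (X₁ := Derives C₁) (X₂ := Derives C₂) .seq
    Derives.avoids hB.valid, fun v hv hP => ?_, fun v hv hP => ?_, fun j hj => ?_⟩
  · exact hB.notMem v (fun h => hv (.inr h)) (hA.notMem v (fun h => hv (.inl h)) hP)
  · exact column_mul (hA.column v (fun h => hv (.inl h)) hP)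
      (hB.column v (fun h => hv (.inr h)) (hA.notMem v (fun h => hv (.inl h)) hP))
  · set M : ℕ → DepMatrix n := fun t => if t = 0 then A else B with hM
    have hseg : seg M 0 2 = A * B := by
      rw [seg_succ M (by omega : 0 ≤ 1), seg_one]
      rfl
    have hseg1 : seg M 1 2 = B := seg_one M 1
    have key := hK' 2 M (fun t => Fin.ofNat 3 t)
      (fun t => if t = 0 then x.withOne else if t = 1 then z.withOne else y.withOne) (some j)
      ?_ ?_ ?_
    · rw [hseg] at key
      exact key
    · intro t ht k
      interval_cases t
      · exact hA.valid.unique k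
      · exact hB.valid.unique k
    · intro s t k hst ht hlab
      exfalso
      interval_cases t <;> interval_cases s <;> simp [Fin.ext_iff] at hlab
    · intro t ht k hk
      interval_cases t
      · change z.withOne k ≤ growth K A x.withOne k
        rcases k with _ | k
        · exact hA.valid.one_le_growth K x
        · refine hA.le_growth k fun i hi => ?_
          change seg M 1 2 (some k) (some j) ≠ 0 at hk
          rw [hseg1] at hk
          obtain ⟨α, -, hα⟩ := hB.valid.exists_unary hk
          have := Derives.seq hi hα (.unary_unary _ _ _ _ _)
          rw [DepType.three_sup] at this
          exact hj _ this
      · change y.withOne k ≤ growth K B z.withOne k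
        change seg M 2 2 k (some j) ≠ 0 at hk
        rw [seg_self] at hk
        obtain rfl : k = some j := by
          by_contra hc
          exact hk (Matrix.one_apply_ne hc)
        refine hB.le_growth j fun i hi => ?_
        obtain ⟨m, hm⟩ := hA.valid.nonzero i hi.avoids
        obtain ⟨α, -, hα⟩ := hA.valid.exists_unary hm
        have := Derives.seq hα hi (.unary_unary _ _ _ _ _)
        rw [DepType.sup_three] at this
        exact hj _ this

/-! #### Loops -/

theorem relPow.exists_run {α : Type} {R : α → α → Prop} {k : ℕ} {x y : α} (h : relPow R k x y) :
    ∃ s : ℕ → α, s 0 = x ∧ s k = y ∧ ∀ t < k, R (s t) (s (t + 1)) := by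
  induction k generalizing y with
  | zero => exact ⟨fun _ => x, rfl, h, by simp⟩
  | succ k ih =>
    obtain ⟨z, hz, hzy⟩ := h
    obtain ⟨s, h0, hk, hs⟩ := ih hz
    refine ⟨fun t => if t ≤ k then s t else y, by simpa using h0, by simp, fun t ht => ?_⟩
    rcases Nat.lt_succ_iff_lt_or_eq.1 ht with h1 | rfl
    · simpa [h1.le, Nat.succ_le_of_lt h1] using hs t h1
    · simpa [hk] using hzy

/-- A run of `T` iterations of `C`, with contexts `p` and matrices `A` that bound the steps. -/
structure BoundedRun (C : Cmd n) (K T : ℕ) (p : ℕ → Ctx n) (A : ℕ → DepMatrix n)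
    (s : ℕ → Store n) : Prop where
  step : ∀ t < T, Abstracts C K (p t) (p (t + 1)) (A t) (s t) (s (t + 1))

theorem Cmd.HasBound.exists_boundedRun {C : Cmd n} {K : ℕ} (hC : C.HasBound K) {P : Ctx n}
    {s : ℕ → Store n} (hP : ∀ i ∈ P, s 0 i = 0) (T : ℕ)
    (hs : ∀ t < T, C.Rel .bounded (s t) (s (t + 1))) :
    ∃ p A, p 0 = P ∧ BoundedRun C K T p A s := by
  suffices h : ∃ p A, p 0 = P ∧ (∀ i ∈ p T, s T i = 0) ∧ BoundedRun C K T p A s by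
    obtain ⟨p, A, h0, -, h⟩ := h
    exact ⟨p, A, h0, h⟩
  induction T with
  | zero => exact ⟨fun _ => P, fun _ => 0, rfl, hP, ⟨by simp⟩⟩
  | succ T ih =>
    obtain ⟨p, A, h0, hT, h⟩ := ih fun t ht => hs t (by omega)
    obtain ⟨Q, B, hB⟩ := hC (p T) (s T) (s (T + 1)) hT (hs T (by omega))
    refine ⟨fun t => if t ≤ T then p t else Q, fun t => if t < T then A t else B,
      by simpa using h0, by simpa using hB.eq_zero, ⟨fun t ht => ?_⟩⟩
    rcases Nat.lt_succ_iff_lt_or_eq.1 ht with h1 | rfl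
    · simpa [h1, h1.le, Nat.succ_le_of_lt h1] using h.step t h1
    · simpa using hB

/-! ### Cycles and type 3 dependences along a run of a loop body -/

namespace BoundedRun

variable {C : Cmd n} {K T : ℕ} {p : ℕ → Ctx n} {A : ℕ → DepMatrix n} {s : ℕ → Store n}

theorem valid (h : BoundedRun C K T p A s) {a b : ℕ} (hab : a < b) (hb : b ≤ T) :
    Valid (Iter C) (p a) (p b) (seg A a b) := by
  induction b, hab using Nat.le_induction with
  | base =>
    rw [Nat.succ_eq_add_one, seg_one]
    exact (h.step a hb).valid.mono fun _ => .single
  | succ b hab ih =>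
    rw [seg_succ A (Nat.le_of_succ_le hab)]
    exact (ih (Nat.le_of_succ_le hb)).mul (X₂ := Derives C) .snoc Derives.avoids
      (h.step b hb).valid

theorem const_eq_one (h : BoundedRun C K T p A s) {a b : ℕ} (hab : a ≤ b) (hb : b ≤ T) :
    seg A a b none none = 1 := by
  rcases hab.lt_or_eq with hab | rfl
  · rw [(h.valid hab hb).const, if_pos rfl]
  · rw [seg_self, Matrix.one_apply_eq]

theorem notMem (h : BoundedRun C K T p A s) {v : Fin n} (hv : ¬ C.Assigns v) (h0 : v ∉ p 0)
    {t : ℕ} (ht : t ≤ T) : v ∉ p t := by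
  induction t with
  | zero => exact h0
  | succ t ih => exact (h.step t ht).notMem v hv (ih (by omega))

theorem column (h : BoundedRun C K T p A s) {v : Fin n} (hv : ¬ C.Assigns v) (h0 : v ∉ p 0)
    {t : ℕ} (ht : t ≤ T) (i : Option (Fin n)) :
    seg A 0 t i (some v) = if i = some v then 1 else 0 := by
  induction t generalizing i with
  | zero => rw [seg_self, Matrix.one_apply]
  | succ t ih =>
    rw [seg_succ A (Nat.zero_le t)]
    exact column_mul (ih (by omega)) ((h.step t ht).column v hv (h.notMem hv h0 (by omega))) i

variable {ℓ : Fin n}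

/-- The loop correction of a cycle, in context. -/
theorem exists_derives_loopCorr (h : BoundedRun C K T p A s) (hℓ : ¬ C.Assigns ℓ) (h0 : ℓ ∉ p 0)
    {a b : ℕ} (hab : a < b) (hb : b ≤ T) (hp : p a = p b) {k j : Fin n} {δ β : DepType}
    (hcycle : Iter C (p a) (.unary k δ k) (p b))
    (hLC : Dep.LoopCorr ℓ (.unary k δ k) (.unary ℓ β k))
    (hkj : seg A b T (some k) (some j) ≠ 0) :
    ∃ α : DepType, α ≠ .three ∧ Derives (.loop ℓ C) (p 0) (.unary ℓ (β ⊔ α) j) (p T) := by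
  have hℓa : ℓ ∉ p a := h.notMem hℓ h0 (by omega)
  -- The preamble only carries the unassigned `ℓ` along; it is empty if the cycle starts at time 0.
  have h1 : Derives (.loop ℓ C) (p 0) (.unary ℓ .one ℓ) (p a) := by
    rcases Nat.eq_zero_or_pos a with rfl | ha
    · exact .loop_zero (.skip h0)
    · refine Iter.loop h0 ((h.valid ha (by omega)).narrow ℓ ℓ ?_ ?_)
      · rw [h.column hℓ h0 (by omega), if_pos rfl]
      · rw [h.column hℓ h0 (by omega), if_neg (by simp)]
        omega
  have h2 : Derives (.loop ℓ C) (p a) (.unary k δ k) (p a) := by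
    have := hcycle.loop hℓa
    rwa [← hp] at this
  obtain ⟨α, hα, h3⟩ : ∃ α : DepType, α ≠ .three ∧
      Derives (.loop ℓ C) (p a) (.unary k α j) (p T) := by
    rcases hb.lt_or_eq with hb | rfl
    · obtain ⟨α, hα, hα'⟩ := (h.valid hb le_rfl).exists_unary hkj
      rw [hp] at hℓa ⊢
      exact ⟨α, hα, hα'.loop hℓa⟩
    · rw [seg_self] at hkj
      obtain rfl : k = j := by
        by_contra hc
        exact hkj (Matrix.one_apply_ne (by simpa using hc))
      rw [← hp]
      exact ⟨.one, by simp, .loop_zero (.skip hcycle.avoids)⟩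
  refine ⟨α, hα, .loop_corr h0 h1 h2 h3 hLC (.unary_unary _ _ _ _ _) ?_⟩
  have := Dep.Comp.unary_unary ℓ k j (DepType.one ⊔ β) α
  rwa [DepType.one_sup] at this ⊢

/-- Dependences of type `3` in an iteration persist. -/
theorem exists_derives_three (h : BoundedRun C K T p A s) (h0 : ℓ ∉ p 0) {t : ℕ}
    (ht : t < T) {i k j : Fin n} (hd : Derives C (p t) (.unary i .three k) (p (t + 1)))
    (hkj : seg A (t + 1) T (some k) (some j) ≠ 0) :
    ∃ i, Derives (.loop ℓ C) (p 0) (.unary i .three j) (p T) := by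
  obtain ⟨i₀, hi₀⟩ : ∃ i₀, Iter C (p 0) (.unary i₀ .three k) (p (t + 1)) := by
    rcases Nat.eq_zero_or_pos t with rfl | ht0
    · exact ⟨i, .single hd⟩
    · obtain ⟨i₀, hi₀⟩ := (h.valid ht0 ht.le).nonzero i hd.avoids
      obtain ⟨α, -, hα⟩ := (h.valid ht0 ht.le).exists_unary hi₀
      have := Iter.snoc hα hd (.unary_unary _ _ _ _ _)
      rw [DepType.sup_three] at this
      exact ⟨i₀, this⟩
  have key : ∀ b, t + 1 ≤ b → b ≤ T → ∀ m, seg A (t + 1) b (some k) (some m) ≠ 0 →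
      Iter C (p 0) (.unary i₀ .three m) (p b) := by
    intro b hb
    induction b, hb using Nat.le_induction with
    | base =>
      intro _ m hm
      rw [seg_self] at hm
      obtain rfl : k = m := by
        by_contra hc
        exact hm (Matrix.one_apply_ne (by simpa using hc))
      exact hi₀
    | succ b hb ih =>
      intro hbT m hm
      rw [seg_succ A hb] at hm
      obtain ⟨m', hm', hm''⟩ := exists_of_entry_mul_ne_zero hm
      have hm'_some : ∃ q, m' = some q := by
        rcases m' with _ | q
        · rcases hb.lt_or_eq with hb | rfl
          · exact (h.valid hb (by omega)).ne_none hm'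
          · rw [seg_self] at hm'
            exact absurd (Matrix.one_apply_ne (by simp)) hm'
        · exact ⟨q, rfl⟩
      obtain ⟨q, rfl⟩ := hm'_some
      obtain ⟨α, -, hα⟩ := (h.step b hbT).valid.exists_unary hm''
      have := Iter.snoc (ih (by omega) q hm') hα (.unary_unary _ _ _ _ _)
      rwa [DepType.three_sup] at this
  exact ⟨i₀, (key T ht le_rfl j hkj).loop h0⟩

/-- The growth in every step towards a final variable without dependences of type `3`. -/
theorem step_le_growth (h : BoundedRun C K T p A s) (h0 : ℓ ∉ p 0) {j : Fin n}
    (hj : ∀ i, ¬ Derives (.loop ℓ C) (p 0) (.unary i .three j) (p T)) {t : ℕ} (ht : t < T)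
    {k : Option (Fin n)} (hk : seg A (t + 1) T k (some j) ≠ 0) :
    (s (t + 1)).withOne k ≤ growth K (A t) (s t).withOne k := by
  rcases k with _ | k
  · exact (h.step t ht).valid.one_le_growth K (s t)
  · refine (h.step t ht).le_growth k fun i hi => ?_
    obtain ⟨i', hi'⟩ := h.exists_derives_three h0 ht hi hk
    exact hj _ hi'

/-- At a variable, the cycle would have type 2 and its loop correction would derive type 3 for `j`.
At the constant the diagonal entry is always 1. -/
theorem not_double_cycle (h : BoundedRun C K T p A s) (hℓ : ¬ C.Assigns ℓ) (h0 : ℓ ∉ p 0)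
    {j : Fin n} (hj : ∀ i, ¬ Derives (.loop ℓ C) (p 0) (.unary i .three j) (p T)) {a b : ℕ}
    {k : Option (Fin n)} (hab : a < b) (hb : b ≤ T) (hp : p a = p b)
    (hk : seg A b T k (some j) ≠ 0) : seg A a b k k < 2 := by
  by_contra! hc
  rcases k with _ | k
  · have := h.const_eq_one hab.le hb
    omega
  · obtain ⟨α, -, hα⟩ := h.exists_derives_loopCorr hℓ h0 hab hb hp
      ((h.valid hab hb).many k k hc) (.two k) hk
    rw [DepType.three_sup] at hα
    exact hj _ hα

end BoundedRun

/-- The contexts serve as labels. Targets fed by an additive cycle may grow polynomially in the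
number of iterations and are charged to `ℓ`; the others obey the bound independent of that number.
-/
theorem hasBound_loop (n K : ℕ) : ∃ K', ∀ (C : Cmd n) (ℓ : Fin n), ¬ C.Assigns ℓ → C.HasBound K →
    (Cmd.loop ℓ C).HasBound K' := by
  obtain ⟨K₁, hK₁⟩ := exists_growth_of_no_wide_cycle (Ctx n) (none : Option (Fin n)) K
  obtain ⟨K₂, hK₂⟩ := exists_growth_of_no_double_cycle (ι := Option (Fin n)) (Ctx n) K
  obtain ⟨K₃, hK₃⟩ : MonoBdd fun S => S + K₂ * (2 * S) ^ K₂ :=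
    monoBdd_id.add ((monoBdd_id.const_mul 2).monomial K₂)
  refine ⟨max K₁ K₃, fun C ℓ hℓ hC => ?_⟩
  rintro P x y hx ⟨T, hT, hr⟩
  obtain ⟨s, rfl, rfl, hs⟩ := hr.exists_run
  rcases Nat.eq_zero_or_pos T with rfl | hT0
  · obtain ⟨A, hA⟩ := abstracts_skip hx (max K₁ K₃)
    exact ⟨P, A, hA.eq_zero, hA.valid.mono fun _ => .loop_zero, fun v _ hv => hv,
      fun v _ => hA.column v not_false, fun j hj => hA.le_growth j fun i hi => hj i (.loop_zero hi)⟩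
  obtain ⟨p, A, rfl, h⟩ := hC.exists_boundedRun hx T hs
  have h0 : ℓ ∉ p 0 := fun hmem => by
    have := hx ℓ hmem
    omega
  classical
  set M := seg A 0 T with hM
  have hMv : Valid (Iter C) (p 0) (p T) M := h.valid hT0 le_rfl
  -- the final variables that are reached by an additive cycle
  let flag : Option (Fin n) → Prop := fun j => ∃ a b k, a < b ∧ b ≤ T ∧ p a = p b ∧
    seg A a b k k = 1 ∧ 2 ≤ seg A a b none k ∧ seg A b T k j ≠ 0 ∧
    ∃ j', j = some j' ∧ Derives (.loop ℓ C) (p 0) (.unary ℓ .two j') (p T)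
  have hflag_wide : ∀ j, flag j → 2 ≤ M none j := by
    rintro j ⟨a, b, k, hab, hb, -, -, h2, h3, -⟩
    rw [hM, ← seg_mul_seg A (Nat.zero_le b) hb, ← seg_mul_seg A (Nat.zero_le a) hab.le]
    refine two_le_entry_mul_left (two_le_entry_mul_right (j := none) ?_ h2) h3
    rw [h.const_eq_one (Nat.zero_le a) (by omega)]
    exact one_ne_zero
  -- Adding 2 makes `ℓ` an argument of the monomial in flagged columns. These are wide already, so
  -- narrow columns and the row of the constant are untouched.
  let R : DepMatrix n := fun i j => M i j + if i = some ℓ ∧ flag j then 2 else 0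
  have hRM : ∀ i j, ¬ (i = some ℓ ∧ flag j) → R i j = M i j := fun i j hij => by
    simp only [R, if_neg hij, add_zero]
  have hR2 : ∀ j, flag j → 2 ≤ R (some ℓ) j := fun j hj => by
    simp only [R, true_and, if_pos hj]
    omega
  have hR1 : ∀ i j, R i j = 1 → M i j = 1 := fun i j hij => by
    simp only [R] at hij
    split_ifs at hij <;> omega
  have hRnone : ∀ j, R none j = M none j := fun j => hRM _ _ (by simp)
  have hRnarrow : ∀ j, ¬ flag j → ∀ i, R i j = M i j := fun j hj i => hRM _ _ fun h => hj h.2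
  refine ⟨p T, R, ?_, ⟨?_, ?_, ?_, ?_, ?_, ?_, ?_⟩, ?_, ?_, ?_⟩
  · obtain ⟨t, rfl⟩ : ∃ t, T = t + 1 := ⟨T - 1, by omega⟩
    exact (h.step t (by omega)).eq_zero
  · intro i j hij
    by_cases hf : i = ℓ ∧ flag (some j)
    · obtain ⟨rfl, a, b, k, -, -, -, -, -, -, j', hj', hd⟩ := hf
      obtain rfl : j = j' := by simpa using hj'
      exact hd
    · rw [hRM _ _ (by simpa using hf)] at hij
      exact (hMv.many i j hij).loop h0
  · intro i j hij hw
    rw [hRnone] at hw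
    exact (hMv.wide i j (hR1 _ _ hij) hw).loop h0
  · intro i j hij hw
    rw [hRnone] at hw
    exact (hMv.narrow i j (hR1 _ _ hij) hw).loop h0
  · intro i i' j j' hij hij' hne
    exact (hMv.pair i i' j j' (hR1 _ _ hij) (hR1 _ _ hij') hne).loop h0
  · intro i
    rw [hRnarrow, hMv.const]
    rintro ⟨_, _, _, -, -, -, -, -, -, _, hj, -⟩
    simp at hj
  · intro j hw i i'
    rw [hRnone] at hw
    have hf : ¬ flag j := fun hf => by
      have := hflag_wide j hf
      omega
    simp only [hRnarrow j hf]
    exact hMv.unique j hw i i'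
  · intro j hj
    obtain ⟨i, hi⟩ := hMv.nonzero j hj
    exact ⟨i, by simp only [R]; omega⟩
  · exact fun v hv hP => h.notMem hv hP le_rfl
  · intro v hv hP i
    rw [hRnarrow]
    · exact h.column hv hP le_rfl i
    · intro hf
      have := hflag_wide _ hf
      rw [hM, h.column hv hP le_rfl, if_neg (by simp)] at this
      omega
  · intro j hj
    have hstep := fun t (ht : t < T) k (hk : seg A (t + 1) T k (some j) ≠ 0) =>
      h.step_le_growth h0 hj ht hk
    by_cases hf : flag (some j)
    · refine le_trans ?_ (growth_mono (le_max_right K₁ K₃) _ _ _)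
      have key := hK₂ T A p (fun t => (s t).withOne) (some j)
        (fun a b k hab hb hp hk => h.not_double_cycle hℓ h0 hj hab hb hp hk) hstep
      rw [← hM] at key
      set x := (s 0).withOne with hxdef
      have hxℓ : x (some ℓ) = s 0 ℓ := rfl
      have hxnone : x none = 1 := rfl
      set S := ∑ i with 2 ≤ R i (some j), x i with hS
      -- Both `ℓ` and the constant occur in `S`, so `T + 1 ≤ S`. This explains the argument `2 * S`
      -- in the choice of `K₃`.
      have hSpair : s 0 ℓ + 1 ≤ S := by
        rw [← hxℓ, ← hxnone, ← Finset.sum_pair (f := x) (by simp : some ℓ ≠ none)]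
        refine Finset.sum_le_sum_of_subset fun i hi => ?_
        simp only [mem_insert, mem_singleton] at hi
        refine Finset.mem_filter.2 ⟨mem_univ i, ?_⟩
        rcases hi with rfl | rfl
        · exact hR2 _ hf
        · rw [hRnone]
          exact hflag_wide _ hf
      have hSM : ∑ i with 2 ≤ M i (some j), x i ≤ S := by
        refine Finset.sum_le_sum_of_subset fun i hi => ?_
        simp only [mem_filter, mem_univ, true_and, R] at hi ⊢
        omega
      -- A unit entry in row `ℓ` of `M` is no longer one in `R`; the lost summand is absorbed by the
      -- summand `S` in `K₃`.
      have hunit : ∑ i with M i (some j) = 1, x i ≤ ∑ i with R i (some j) = 1, x i + s 0 ℓ := by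
        have hsub : (univ.filter fun i => M i (some j) = 1) ⊆
            insert (some ℓ) (univ.filter fun i => R i (some j) = 1) := by
          intro i hi
          by_cases hi' : i = some ℓ
          · simp [hi']
          · refine mem_insert_of_mem (Finset.mem_filter.2 ⟨mem_univ i, ?_⟩)
            rw [hRM _ _ fun h => hi' h.1]
            exact (Finset.mem_filter.1 hi).2
        refine (Finset.sum_le_sum_of_subset hsub).trans ?_
        rw [Finset.sum_insert, add_comm, hxℓ]
        intro hmem
        have := hR2 _ hf
        have := (Finset.mem_filter.1 hmem).2
        omega
      have hmono : K₂ * (T + 1 + ∑ i with 2 ≤ M i (some j), x i) ^ K₂ ≤ K₂ * (2 * S) ^ K₂ :=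
        mul_pow_mono le_rfl (by omega)
      have hfin := hK₃ S
      change s T j ≤ _ at key
      rw [growth, ← hS]
      dsimp only at hfin
      omega
    · refine le_trans ?_ (growth_mono (le_max_left K₁ K₃) _ _ _)
      have key := hK₁ T A p (fun t => (s t).withOne) (some j)
        (fun t ht k => (h.step t ht).valid.unique k) ?_ hstep
      · rw [growth] at key ⊢
        simp only [hRnarrow _ hf]
        exact key
      · intro a b k hab hb hp hk hkk
        by_contra! hc
        have hlt := h.not_double_cycle hℓ h0 hj hab hb hp hk
        rcases k with _ | k
        · omega
        have hkk1 : seg A a b (some k) (some k) = 1 := by omega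
        refine hf ⟨a, b, some k, hab, hb, hp, hkk1, hc, hk, j, rfl, ?_⟩
        obtain ⟨α, hα, hd⟩ := h.exists_derives_loopCorr hℓ h0 hab hb hp
          ((h.valid hab hb).wide k k hkk1 hc) (.onePlus k) hk
        rwa [DepType.two_sup hα] at hd

theorem exists_hasBound (C : Cmd n) (hC : C.WellFormed) : ∃ K, C.HasBound K := by
  induction C with
  | skip =>
    refine ⟨0, fun P x y hx hr => ?_⟩
    obtain rfl : x = y := hr
    obtain ⟨A, hA⟩ := abstracts_skip hx 0
    exact ⟨P, A, hA⟩
  | assign l e => exact ⟨2, hasBound_assign l e hC⟩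
  | seq C₁ C₂ ih₁ ih₂ =>
    obtain ⟨K₁, h₁⟩ := ih₁ hC.1
    obtain ⟨K₂, h₂⟩ := ih₂ hC.2
    obtain ⟨K, hK⟩ := hasBound_seq n (max K₁ K₂)
    exact ⟨K, hK C₁ C₂ (h₁.mono (le_max_left _ _)) (h₂.mono (le_max_right _ _))⟩
  | loop ℓ C ih =>
    obtain ⟨K, h⟩ := ih hC.2
    obtain ⟨K', hK'⟩ := hasBound_loop n K
    exact ⟨K', hK' C ℓ hC.1 h⟩
  | choose C₁ C₂ ih₁ ih₂ =>
    obtain ⟨K₁, h₁⟩ := ih₁ hC.1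
    obtain ⟨K₂, h₂⟩ := ih₂ hC.2
    refine ⟨max K₁ K₂, fun P x y hx hr => ?_⟩
    rcases hr with hr | hr
    · obtain ⟨Q, A, hA⟩ := h₁ P x y hx hr
      exact ⟨Q, A, (hA.mono (le_max_left _ _)).choose_left C₂⟩
    · obtain ⟨Q, A, hA⟩ := h₂ P x y hx hr
      exact ⟨Q, A, (hA.mono (le_max_right _ _)).choose_right C₁⟩

/-! #### Polynomial bounds in both semantics -/

theorem relPow_mono {α : Type} {R S : α → α → Prop} (h : ∀ x y, R x y → S x y) (k : ℕ) :
    ∀ x y, relPow R k x y → relPow S k x y := by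
  induction k with
  | zero => exact fun x y h => h
  | succ k ih =>
    rintro x y ⟨z, hz, hzy⟩
    exact ⟨z, ih x z hz, h z y hzy⟩

theorem Cmd.Rel.of_exact {C : Cmd n} {x y : Store n} (h : C.Rel .exact x y) (σ : AssignMode) :
    C.Rel σ x y := by
  cases σ with
  | exact => exact h
  | bounded =>
    induction C generalizing x y with
    | skip => exact h
    | assign l e =>
      obtain ⟨w, hw, hy⟩ := h
      exact ⟨w, le_of_eq hw, hy⟩
    | seq C₁ C₂ ih₁ ih₂ =>
      obtain ⟨z, hz, hzy⟩ := h
      exact ⟨z, ih₁ hz, ih₂ hzy⟩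
    | loop ℓ C ih =>
      obtain ⟨k, hk, hr⟩ := h
      exact ⟨k, hk, relPow_mono (fun x y => ih) k x y hr⟩
    | choose C₁ C₂ ih₁ ih₂ => exact h.imp ih₁ ih₂

theorem Cmd.Rel.bounded {σ : AssignMode} {C : Cmd n} {x y : Store n} (h : C.Rel σ x y) :
    C.Rel .bounded x y := by
  cases σ with
  | exact => exact h.of_exact _
  | bounded => exact h

theorem polyBounded_of_not_derives (σ : AssignMode) (C : Cmd n) (hC : C.WellFormed) (j : Fin n)
    (hj : ¬ ∃ (i : Fin n) (Q : Ctx n), Derives C ∅ (.unary i .three j) Q) :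
    C.PolyBounded σ j := by
  obtain ⟨K, hK⟩ := exists_hasBound C hC
  -- The sum of all values including the constant dominates both sums in `growth`, so a single
  -- polynomial serves all runs.
  let q : MvPolynomial (Fin n) ℕ := 1 + ∑ i, MvPolynomial.X i
  refine ⟨q + MvPolynomial.C K * q ^ K, fun x y hr => ?_⟩
  obtain ⟨Q, A, hA⟩ := hK ∅ x y (by simp) hr.bounded
  refine (hA.le_growth j fun i hi => hj ⟨i, Q, hi⟩).trans ?_
  have hq : MvPolynomial.eval x q = ∑ i, x.withOne i := by
    rw [Fintype.sum_option]
    simp [q, Store.withOne]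
  rw [map_add, map_mul, map_pow, MvPolynomial.eval_C, hq, growth]
  exact add_le_add (Finset.sum_le_sum_of_subset (Finset.filter_subset _ _))
    (mul_pow_mono le_rfl (Finset.sum_le_sum_of_subset (Finset.filter_subset _ _)))

/-! ### Lower bounds for commands -/

/-- The lower bound on the final value `b` in terms of the initial value `a` that is expressed by
a dependence type, when all nonzero values are at least `N`. -/
def DepType.Lower (c N a b : ℕ) : DepType → Prop
  | .one => a ≤ b
  | .onePlus => a + N ≤ b
  | .two => 2 * a ≤ b
  | .three => a ≤ b ∧ 2 ^ (a / c) ≤ b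

theorem DepType.Lower.le {c N a b : ℕ} {δ : DepType} (h : δ.Lower c N a b) : a ≤ b := by
  cases δ with
  | one => exact h
  | onePlus => exact (Nat.le_add_right _ _).trans h
  | two => exact (Nat.le_mul_of_pos_left _ two_pos).trans h
  | three => exact h.1

theorem DepType.Lower.mono {c c' N a a' b b' : ℕ} {δ : DepType} (h : δ.Lower c N a b)
    (hc0 : 0 < c) (hc : c ≤ c') (ha : a' ≤ a) (hb : b ≤ b') : δ.Lower c' N a' b' := by
  cases δ with
  | one => exact ha.trans (h.trans hb)
  | onePlus => exact (Nat.add_le_add_right ha N).trans (h.trans hb)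
  | two => exact (Nat.mul_le_mul_left 2 ha).trans (h.trans hb)
  | three => exact ⟨ha.trans (h.1.trans hb),
      (Nat.pow_le_pow_right two_pos (Nat.div_le_div ha hc hc0.ne')).trans (h.2.trans hb)⟩

/-- The maximum is one of the two types. From the other one only `a ≤ b` is used. -/
theorem DepType.Lower.trans {c N x y z : ℕ} {α β : DepType} (hc : 0 < c) (h : α.Lower c N x y)
    (h' : β.Lower c N y z) : (α ⊔ β).Lower c N x z := by
  rcases max_choice α β with he | he
  · rw [he]
    exact h.mono hc le_rfl le_rfl h'.le
  · rw [he]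
    exact h'.mono hc le_rfl h.le le_rfl

/-- The lower bounds on final values in `y` in terms of initial values in `x` that are expressed
by a dependence. -/
def Dep.Lower (c N : ℕ) (x y : Store n) : Dep n → Prop
  | .unary i δ j => δ.Lower c N (x i) (y j)
  | .binary i i' j j' => x i ≤ y j ∧ x i' ≤ y j' ∧ (j = j' → x i + x i' ≤ y j) ∧ (i ≠ i' ∨ j ≠ j')

theorem Dep.Lower.mono {c c' N : ℕ} {x y : Store n} {D : Dep n} (h : D.Lower c N x y)
    (hc0 : 0 < c) (hc : c ≤ c') : D.Lower c' N x y := by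
  cases D with
  | unary i δ j => exact DepType.Lower.mono h hc0 hc le_rfl le_rfl
  | binary i i' j j' => exact h

theorem Dep.Lower.comp {c N : ℕ} {x y z : Store n} {D D' E : Dep n} (hc : 0 < c)
    (h : D.Lower c N x y) (h' : D'.Lower c N y z) (hE : Dep.Comp D D' E) : E.Lower c N x z := by
  cases hE with
  | unary_unary i j k α β => exact DepType.Lower.trans hc h h'
  | unary_binary i j k k' α hα =>
    have h := DepType.Lower.le h
    obtain ⟨h1, h2, h3, h4⟩ := h'
    exact ⟨h.trans h1, h.trans h2, fun hk => absurd hk (by simpa using h4),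
      .inr (by simpa using h4)⟩
  | binary_unary i i' j k α hα =>
    have h' := DepType.Lower.le h'
    obtain ⟨h1, h2, h3, h4⟩ := h
    exact ⟨h1.trans h', h2.trans h', fun _ => (h3 rfl).trans h', .inl (by simpa using h4)⟩
  | binary_binary i i' j j' k k' hne =>
    obtain ⟨h1, h2, h3, h4⟩ := h
    obtain ⟨h5, h6, h7, h8⟩ := h'
    refine ⟨h1.trans h5, h2.trans h6, fun hk => ?_, hne⟩
    have := h7 hk
    omega
  | binary_binary_eq i j j' k =>
    obtain ⟨h1, h2, h3, h4⟩ := h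
    obtain ⟨h5, h6, h7, h8⟩ := h'
    have := h7 rfl
    change 2 * x i ≤ z k
    omega

/-- The store `x` is zero exactly on `P`, and its other values are at least `N`. -/
def Store.Fits (N : ℕ) (P : Ctx n) (x : Store n) : Prop :=
  (∀ i ∈ P, x i = 0) ∧ ∀ i, i ∉ P → N ≤ x i

/-- For stores with large nonzero values, `R` has a transition that realizes `D`. -/
def Realizes (R : Store n → Store n → Prop) (c : ℕ) (P : Ctx n) (D : Dep n) (Q : Ctx n) : Prop :=
  ∀ N, c ≤ N → ∀ x : Store n, x.Fits N P → ∃ y, R x y ∧ y.Fits N Q ∧ D.Lower c N x y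

theorem Realizes.mono {R : Store n → Store n → Prop} {c c' : ℕ} {P Q : Ctx n} {D : Dep n}
    (h : Realizes R c P D Q) (hc0 : 0 < c) (hc : c ≤ c') : Realizes R c' P D Q :=
  fun N hN x hx =>
    let ⟨y, h1, h2, h3⟩ := h N (hc.trans hN) x hx
    ⟨y, h1, h2, h3.mono hc0 hc⟩

theorem Realizes.comp {R R' : Store n → Store n → Prop} {c : ℕ} {P Q S : Ctx n} {D D' E : Dep n}
    (hc : 0 < c) (h : Realizes R c P D Q) (h' : Realizes R' c Q D' S) (hE : Dep.Comp D D' E) :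
    Realizes (Relation.Comp R R') c P E S := fun N hN x hx =>
  let ⟨y, h1, h2, h3⟩ := h N hN x hx
  let ⟨z, h4, h5, h6⟩ := h' N hN y h2
  ⟨z, ⟨y, h1, h4⟩, h5, h3.comp hc h6 hE⟩

theorem Realizes.imp {R R' : Store n → Store n → Prop} {c : ℕ} {P Q : Ctx n} {D : Dep n}
    (h : Realizes R c P D Q) (hR : ∀ x y, R x y → R' x y) : Realizes R' c P D Q :=
  fun N hN x hx =>
    let ⟨y, h1, h2⟩ := h N hN x hx
    ⟨y, hR x y h1, h2⟩

theorem relPow_one {α : Type} {R : α → α → Prop} {x y : α} (h : R x y) : relPow R 1 x y :=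
  ⟨x, rfl, h⟩

theorem relPow_add {α : Type} {R : α → α → Prop} {a b : ℕ} {x y z : α} (h : relPow R a x y)
    (h' : relPow R b y z) : relPow R (a + b) x z := by
  induction b generalizing z with
  | zero =>
    obtain rfl : y = z := h'
    exact h
  | succ b ih =>
    obtain ⟨w, hw, hwz⟩ := h'
    exact ⟨w, ih hw, hwz⟩

/-! #### Variables that are not assigned -/

/-- The only dependence of `v` in `D`, if any, is the one on its own initial value. -/
def Dep.Keeps (v : Fin n) : Dep n → Prop
  | .unary i δ j => j = v → i = v ∧ δ = .one
  | .binary i i' j j' => (j = v → i = v) ∧ (j' = v → i' = v) ∧ (i ≠ i' ∨ j ≠ j')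

theorem Dep.Keeps.comp {v : Fin n} {D D' E : Dep n} (h : D.Keeps v) (h' : D'.Keeps v)
    (hE : Dep.Comp D D' E) : E.Keeps v := by
  cases hE with
  | unary_unary i j k α β =>
    intro hk
    obtain ⟨hj, rfl⟩ := h' hk
    obtain ⟨hi, rfl⟩ := h hj
    exact ⟨hi, DepType.one_sup _⟩
  | unary_binary i j k k' α hα =>
    obtain ⟨h1, h2, h3⟩ := h'
    exact ⟨fun hk => (h (h1 hk)).1, fun hk => (h (h2 hk)).1, .inr (by simpa using h3)⟩
  | binary_unary i i' j k α hα =>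
    obtain ⟨h1, h2, h3⟩ := h
    exact ⟨fun hk => h1 (h' hk).1, fun hk => h2 (h' hk).1, .inl (by simpa using h3)⟩
  | binary_binary i i' j j' k k' hne =>
    exact ⟨fun hk => h.1 (h'.1 hk), fun hk => h.2.1 (h'.2.1 hk), hne⟩
  | binary_binary_eq i j j' k =>
    intro hk
    have h1 := h'.1 hk
    have h2 := h'.2.1 hk
    obtain ⟨-, -, h3⟩ := h
    simp_all

theorem Dep.CompSeq.keeps {v : Fin n} {D : ℕ → Dep n} {m : ℕ} {E : Dep n}
    (h : Dep.CompSeq D m E) (hD : ∀ k ≤ m, (D k).Keeps v) : E.Keeps v := by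
  induction h with
  | single => exact hD 0 le_rfl
  | snoc h hF ih => exact (ih fun k hk => hD k (by omega)).comp (hD _ le_rfl) hF

/-- Only cycles of type `1⁺` or `2` are corrected, while an unassigned variable depends on itself
with type 1. -/
theorem Dep.LoopCorr.ne_of_keeps {v ℓ : Fin n} {k : Fin n} {β : DepType} {D : Dep n}
    (h : Dep.LoopCorr ℓ D (.unary ℓ β k)) (hD : D.Keeps v) : k ≠ v := by
  rintro rfl
  cases h <;> simpa using (hD rfl).2

theorem Derives.keeps {C : Cmd n} {P Q : Ctx n} {D : Dep n} (h : Derives C P D Q) {v : Fin n}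
    (hv : ¬ C.Assigns v) : D.Keeps v := by
  induction h with
  | skip => exact fun h => ⟨h, rfl⟩
  | zero => exact fun h => ⟨h, rfl⟩
  | var_other => exact fun h => ⟨h, rfl⟩
  | var_self => exact fun h => absurd h hv
  | mul_other => exact fun h => ⟨h, rfl⟩
  | mul_self => exact fun h => absurd h hv
  | add_other => exact fun h => ⟨h, rfl⟩
  | add_left => exact fun h => absurd h hv
  | add_right => exact fun h => absurd h hv
  | add_both => exact fun h => absurd h hv
  | atomic_binary _ _ _ _ _ hne _ _ _ _ ih₁ ih₂ =>
    exact ⟨fun h => (ih₁ hv h).1, fun h => (ih₂ hv h).1, hne⟩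
  | choose_left _ ih => exact ih fun h => hv (.inl h)
  | choose_right _ ih => exact ih fun h => hv (.inr h)
  | seq _ _ hD ih₁ ih₂ => exact (ih₁ fun h => hv (.inl h)).comp (ih₂ fun h => hv (.inr h)) hD
  | loop_zero _ ih => exact ih not_false
  | loop_iter m P D hℓ h hE ih => exact hE.keeps fun k hk => ih k hk hv
  | loop_corr _ _ _ _ hLC hE hF ih₁ ih₂ ih₃ =>
    refine Dep.Keeps.comp (Dep.Keeps.comp (ih₁ hv) ?_ hE) (ih₃ hv) hF
    cases hLC with
    | onePlus i => exact fun h => by simpa using (ih₂ hv h).2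
    | two i => exact fun h => by simpa using (ih₂ hv h).2

/-! #### Atomic commands -/

theorem Derives.assign_unary {C : Cmd n} {P Q : Ctx n} {D : Dep n} (h : Derives C P D Q)
    {l i j : Fin n} {e : Expr n} {δ : DepType} (hC : C = .assign l e) (hD : D = .unary i δ j) :
    (i = j ∧ j ≠ l) ∨ (j = l ∧ (e = .var i ∨ δ = .two ∨
      ∃ r s, r ≠ s ∧ e = .add r s ∧ (i = r ∨ i = s))) := by
  cases h <;> simp only [Cmd.assign.injEq, reduceCtorEq, Dep.unary.injEq] at hC hD
  all_goals
    obtain ⟨rfl, rfl⟩ := hC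
    obtain ⟨rfl, rfl, rfl⟩ := hD
    simp_all

theorem Derives.skip_unary {C : Cmd n} {P Q : Ctx n} {D : Dep n} (h : Derives C P D Q)
    {i j : Fin n} {δ : DepType} (hC : C = .skip) (hD : D = .unary i δ j) : i = j := by
  cases h <;> simp only [reduceCtorEq, Dep.unary.injEq] at hC hD
  exact hD.1.symm.trans hD.2.2

/-- The transition of a run of `skip` or an assignment, in the exact semantics. -/
def Cmd.atomicStep (x : Store n) : Cmd n → Store n
  | .assign l e => Function.update x l (e.eval x)
  | _ => x

theorem Cmd.IsAtomic.rel {C : Cmd n} (hC : C.IsAtomic) (x : Store n) :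
    C.Rel .exact x (C.atomicStep x) := by
  cases C with
  | skip => exact rfl
  | assign l e => exact ⟨_, rfl, rfl⟩
  | _ => exact hC.elim

/-- Only an addition gives one target two different sources of unit type. -/
theorem Derives.add_le_atomicStep {C : Cmd n} (hC : C.IsAtomic) {P Q : Ctx n} {i i' j : Fin n}
    {δ₁ δ₂ : DepType} (hne : i ≠ i') (hδ₁ : δ₁.IsUnit) (hδ₂ : δ₂.IsUnit)
    (h₁ : Derives C P (.unary i δ₁ j) Q) (h₂ : Derives C P (.unary i' δ₂ j) Q) (x : Store n) :
    x i + x i' ≤ C.atomicStep x j := by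
  cases C with
  | skip => exact absurd ((h₁.skip_unary rfl rfl).trans (h₂.skip_unary rfl rfl).symm) hne
  | assign l e =>
    have hd₁ : δ₁ ≠ .two := by rcases hδ₁ with rfl | rfl <;> simp
    have hd₂ : δ₂ ≠ .two := by rcases hδ₂ with rfl | rfl <;> simp
    rcases h₁.assign_unary rfl rfl with ⟨rfl, hj⟩ | ⟨rfl, he | he | ⟨r, s, hrs, rfl, hi⟩⟩
    · rcases h₂.assign_unary rfl rfl with ⟨rfl, -⟩ | ⟨rfl, -⟩
      · exact absurd rfl hne
      · exact absurd rfl hj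
    · subst he
      rcases h₂.assign_unary rfl rfl with ⟨-, hj⟩ | ⟨-, he | he | ⟨r, s, -, he, -⟩⟩
      · exact absurd rfl hj
      · exact absurd (by simpa using he) hne
      · exact absurd he hd₂
      · simp at he
    · exact absurd he hd₁
    · rcases h₂.assign_unary rfl rfl with ⟨-, hj⟩ | ⟨-, he | he | ⟨r', s', -, he, hi'⟩⟩
      · exact absurd rfl hj
      · simp at he
      · exact absurd he hd₂
      · obtain ⟨rfl, rfl⟩ : r = r' ∧ s = s' := by simpa using he
        simp only [Cmd.atomicStep, Function.update_self, Expr.eval]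
        rcases hi with rfl | rfl <;> rcases hi' with rfl | rfl <;>
          first | exact absurd rfl hne | omega
  | _ => exact hC.elim

theorem Store.Fits.assign {N : ℕ} {P Q : Ctx n} {x : Store n} (hx : x.Fits N P) {l : Fin n}
    {w : ℕ} (hQ : ∀ i, i ≠ l → (i ∈ Q ↔ i ∈ P)) (h0 : l ∈ Q → w = 0) (hN : l ∉ Q → N ≤ w) :
    Store.Fits N Q (Function.update x l w) := by
  refine ⟨fun i hi => ?_, fun i hi => ?_⟩ <;> by_cases h : i = l
  · subst h
    rw [Function.update_self, h0 hi]
  · rw [Function.update_of_ne h]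
    exact hx.1 i ((hQ i h).1 hi)
  · subst h
    rw [Function.update_self]
    exact hN hi
  · rw [Function.update_of_ne h]
    exact hx.2 i fun hP => hi ((hQ i h).2 hP)

theorem Store.Fits.update_set {N : ℕ} {P : Ctx n} {x : Store n} (hx : x.Fits N P) {l : Fin n}
    {w : ℕ} {b : Prop} [Decidable b] (h0 : b → w = 0) (hN : ¬ b → N ≤ w) :
    Store.Fits N (P.set l b) (Function.update x l w) :=
  hx.assign (fun _ => Ctx.mem_set_of_ne) (fun h => h0 (Ctx.mem_set_self.1 h))
    fun h => hN fun hb => h (Ctx.mem_set_self.2 hb)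

theorem Store.Fits.update_var {N : ℕ} {P : Ctx n} {x : Store n} (hx : x.Fits N P) (l r : Fin n) :
    Store.Fits N (P.set l (r ∈ P)) (Function.update x l ((Expr.var r).eval x)) :=
  hx.update_set (hx.1 r) (hx.2 r)

theorem Store.Fits.update_mul {N : ℕ} (hN : 1 ≤ N) {P : Ctx n} {x : Store n} (hx : x.Fits N P)
    (l r s : Fin n) :
    Store.Fits N (P.set l (r ∈ P ∨ s ∈ P)) (Function.update x l ((Expr.mul r s).eval x)) := by
  refine hx.update_set (fun h => ?_) fun h => ?_
  · rcases h with h | h <;> simp [Expr.eval, hx.1 _ h]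
  · have hr := hx.2 r fun hr => h (.inl hr)
    have hs := hx.2 s fun hs => h (.inr hs)
    exact hr.trans (Nat.le_mul_of_pos_right _ (by omega))

theorem Store.Fits.update_add {N : ℕ} {P : Ctx n} {x : Store n} (hx : x.Fits N P)
    (l r s : Fin n) :
    Store.Fits N (P.set l (r ∈ P ∧ s ∈ P)) (Function.update x l ((Expr.add r s).eval x)) := by
  refine hx.update_set (fun h => ?_) fun h => ?_
  · simp [Expr.eval, hx.1 _ h.1, hx.1 _ h.2]
  · simp only [Expr.eval]
    by_cases hr : r ∈ P
    · have := hx.2 s fun hs => h ⟨hr, hs⟩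
      omega
    · have := hx.2 r hr
      omega

/-- The threshold 2 is for products: each factor doubles the other one. -/
theorem Derives.realizes_of_isAtomic {C : Cmd n} {P Q : Ctx n} {D : Dep n} (h : Derives C P D Q)
    (hC : C.IsAtomic) : Realizes (fun x y => y = C.atomicStep x) 2 P D Q := by
  suffices ∀ N, 2 ≤ N → ∀ x : Store n, x.Fits N P →
      Store.Fits N Q (C.atomicStep x) ∧ D.Lower 2 N x (C.atomicStep x) from
    fun N hN x hx => ⟨_, rfl, this N hN x hx⟩
  intro N hN x hx
  have other : ∀ {l i : Fin n} {w : ℕ}, i ≠ l →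
      (Dep.unary i .one i).Lower 2 N x (Function.update x l w) := fun hil => by
    simp [Dep.Lower, DepType.Lower, hil]
  induction h with
  | skip hi => exact ⟨hx, le_rfl⟩
  | zero hi hil =>
    exact ⟨hx.assign (fun i hi => by simp [hi]) (fun _ => rfl) fun h => absurd (by simp) h,
      other hil⟩
  | var_other hi hil => exact ⟨hx.update_var _ _, other hil⟩
  | var_self hr =>
    refine ⟨hx.update_var _ _, ?_⟩
    simp [Dep.Lower, DepType.Lower, Cmd.atomicStep, Expr.eval]
  | mul_other hi hil => exact ⟨hx.update_mul (by omega) _ _ _, other hil⟩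
  | mul_self hr hs ht =>
    refine ⟨hx.update_mul (by omega) _ _ _, ?_⟩
    simp only [Dep.Lower, DepType.Lower, Cmd.atomicStep, Function.update_self, Expr.eval]
    have hr := hx.2 _ hr
    have hs := hx.2 _ hs
    rcases ht with rfl | rfl
    · rw [mul_comm]
      exact Nat.mul_le_mul_left _ (by omega)
    · exact Nat.mul_le_mul_right _ (by omega)
  | add_other _ hi hil => exact ⟨hx.update_add _ _ _, other hil⟩
  | add_left =>
    refine ⟨hx.update_add _ _ _, ?_⟩
    simp [Dep.Lower, DepType.Lower, Cmd.atomicStep, Expr.eval]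
  | add_right =>
    refine ⟨hx.update_add _ _ _, ?_⟩
    simp [Dep.Lower, DepType.Lower, Cmd.atomicStep, Expr.eval]
  | add_both _ hr hs ht =>
    refine ⟨hx.update_add _ _ _, ?_⟩
    simp only [Dep.Lower, DepType.Lower, Cmd.atomicStep, Function.update_self, Expr.eval]
    have hr := hx.2 _ hr
    have hs := hx.2 _ hs
    rcases ht with rfl | rfl <;> omega
  | atomic_binary _ _ _ _ _ hne hδ₁ hδ₂ h₁ h₂ ih₁ ih₂ =>
    refine ⟨(ih₁ hC hx).1, DepType.Lower.le (ih₁ hC hx).2, DepType.Lower.le (ih₂ hC hx).2,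
      ?_, hne⟩
    rintro rfl
    exact h₁.add_le_atomicStep hC (by simpa using hne) hδ₁ hδ₂ h₂ x
  | _ => exact hC.elim

/-! #### Loops -/

theorem Realizes.relPow_compSeq {R : Store n → Store n → Prop} {c : ℕ} (hc : 0 < c)
    {P : ℕ → Ctx n} {D : ℕ → Dep n} {m : ℕ} {E : Dep n} (hE : Dep.CompSeq D m E)
    (h : ∀ k ≤ m, Realizes R c (P k) (D k) (P (k + 1))) :
    Realizes (relPow R (m + 1)) c (P 0) E (P (m + 1)) := by
  induction hE with
  | single => exact (h 0 le_rfl).imp fun x y => relPow_one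
  | snoc _ hF ih => exact (ih fun k hk => h k (by omega)).comp hc (h _ le_rfl) hF

theorem exists_forall_realizes {R : Store n → Store n → Prop} {P : ℕ → Ctx n} {D : ℕ → Dep n}
    {m : ℕ} (h : ∀ k ≤ m, ∃ c, 0 < c ∧ Realizes R c (P k) (D k) (P (k + 1))) :
    ∃ c, 0 < c ∧ ∀ k ≤ m, Realizes R c (P k) (D k) (P (k + 1)) := by
  induction m with
  | zero =>
    obtain ⟨c, hc, h⟩ := h 0 le_rfl
    refine ⟨c, hc, fun k hk => ?_⟩
    obtain rfl : k = 0 := by omega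
    exact h
  | succ m ih =>
    obtain ⟨c, hc, h1⟩ := ih fun k hk => h k (by omega)
    obtain ⟨c', hc', h2⟩ := h (m + 1) le_rfl
    refine ⟨max c c', by omega, fun k hk => ?_⟩
    rcases Nat.lt_or_eq_of_le hk with hk | rfl
    · exact (h1 k (by omega)).mono hc (le_max_left _ _)
    · exact h2.mono hc' (le_max_right _ _)

theorem Realizes.iterate {R : Store n → Store n → Prop} {c m : ℕ} {P : Ctx n} {k : Fin n}
    {δ : DepType} (h : Realizes (relPow R m) c P (.unary k δ k) P) {N : ℕ} (hN : c ≤ N)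
    (r : ℕ) {x : Store n} (hx : x.Fits N P) :
    ∃ y : Store n, relPow R (r * m) x y ∧ y.Fits N P ∧
      (δ = .onePlus → x k + r * N ≤ y k) ∧ (δ = .two → 2 ^ r * x k ≤ y k) := by
  induction r with
  | zero => exact ⟨x, by rw [Nat.zero_mul]; rfl, hx, by simp, by simp⟩
  | succ r ih =>
    obtain ⟨y, h1, h2, h3, h4⟩ := ih
    obtain ⟨z, h5, h6, h7⟩ := h N hN y h2
    refine ⟨z, ?_, h6, ?_, ?_⟩
    · rw [Nat.succ_mul]
      exact relPow_add h1 h5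
    · rintro rfl
      have h7 : y k + N ≤ z k := h7
      have := h3 rfl
      rw [Nat.succ_mul]
      omega
    · rintro rfl
      have h7 : 2 * y k ≤ z k := h7
      have := h4 rfl
      rw [pow_succ, mul_right_comm]
      omega

/-- The preamble and the continuation cost fixed numbers of iterations, and the rest of the budget
`x ℓ` goes into repeating the cycle. Repeated gains of `N` yield twice `x ℓ`; repeated doubling
yields an exponential. -/
theorem Realizes.loopCorr {R : Store n → Store n → Prop} {c m₁ m₂ m₃ : ℕ} {P₀ P₁ P₃ : Ctx n}
    {ℓ k q : Fin n} {δ β γ : DepType} {D₁ : Dep n} (hc : 0 < c) (hℓ : ℓ ∉ P₀) (hk : k ∉ P₁)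
    (h₁ : Realizes (relPow R m₁) c P₀ D₁ P₁)
    (h₂ : Realizes (relPow R m₂) c P₁ (.unary k δ k) P₁)
    (h₃ : Realizes (relPow R m₃) c P₁ (.unary k γ q) P₃)
    (hLC : Dep.LoopCorr ℓ (.unary k δ k) (.unary ℓ β k)) :
    ∃ c', 0 < c' ∧ Realizes (fun x y => ∃ t ≤ x ℓ, relPow R t x y) c' P₀
      (.unary ℓ (β ⊔ γ) q) P₃ := by
  -- This makes the overhead `m₁ + m₂ + m₃ + 1` at most a quarter of `X`, and each gain `N` at least
  -- `4 * (m₂ + 1)`.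
  refine ⟨c + 4 * (m₁ + m₂ + m₃ + 1), by omega, fun N hN x hx => ?_⟩
  have hX := hx.2 ℓ hℓ
  set X := x ℓ
  -- Dividing by `m₂ + 1` avoids a separate case `m₂ = 0`.
  set r := (X - m₁ - m₃) / (m₂ + 1) with hr
  have hr1 : r * (m₂ + 1) ≤ X - m₁ - m₃ := Nat.div_mul_le_self _ _
  have hr2 : X - m₁ - m₃ < (r + 1) * (m₂ + 1) := by
    rw [mul_comm]
    exact Nat.lt_mul_div_succ _ (Nat.succ_pos m₂)
  obtain ⟨x₁, h1, hx₁, -⟩ := h₁ N (by omega) x hx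
  obtain ⟨x₂, h2, hx₂, hp, ht⟩ := h₂.iterate (by omega : c ≤ N) r hx₁
  obtain ⟨x₃, h3, hx₃, hγ⟩ := h₃ N (by omega) x₂ hx₂
  refine ⟨x₃, ⟨m₁ + r * m₂ + m₃, ?_, relPow_add (relPow_add h1 h2) h3⟩, hx₃, ?_⟩
  · rw [mul_add] at hr1
    omega
  · refine DepType.Lower.trans (y := x₂ k) (by omega) ?_
      (DepType.Lower.mono hγ hc (by omega) le_rfl le_rfl)
    have hN' : r * (4 * (m₂ + 1)) ≤ r * N := Nat.mul_le_mul_left r (by omega)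
    have hmul : r * (4 * (m₂ + 1)) = 4 * (r * (m₂ + 1)) := by ring
    rw [add_mul, one_mul] at hr2
    cases hLC with
    | onePlus =>
      have := hp rfl
      change 2 * X ≤ x₂ k
      omega
    | two =>
      have hk := hx₁.2 k hk
      have h2r : r + 1 ≤ 2 ^ r := Nat.lt_two_pow_self
      have h4 := ht rfl
      have h5 : (r + 1) * N ≤ 2 ^ r * x₁ k := Nat.mul_le_mul h2r hk
      rw [add_mul, one_mul] at h5
      refine ⟨by omega, ?_⟩
      have h6 : X / (c + 4 * (m₁ + m₂ + m₃ + 1)) ≤ r := by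
        rw [hr, Nat.le_div_iff_mul_le (Nat.succ_pos m₂)]
        have h7 := Nat.div_mul_le_self X (c + 4 * (m₁ + m₂ + m₃ + 1))
        have h8 : X / (c + 4 * (m₁ + m₂ + m₃ + 1)) * (2 * (m₂ + 1)) ≤
            X / (c + 4 * (m₁ + m₂ + m₃ + 1)) * (c + 4 * (m₁ + m₂ + m₃ + 1)) :=
          Nat.mul_le_mul_left _ (by omega)
        have h9 : X / (c + 4 * (m₁ + m₂ + m₃ + 1)) * (2 * (m₂ + 1)) =
            2 * (X / (c + 4 * (m₁ + m₂ + m₃ + 1)) * (m₂ + 1)) := by ring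
        rw [Nat.succ_eq_add_one]
        omega
      calc 2 ^ (X / (c + 4 * (m₁ + m₂ + m₃ + 1))) ≤ 2 ^ r := Nat.pow_le_pow_right two_pos h6
        _ ≤ 2 ^ r * x₁ k := Nat.le_mul_of_pos_right _ (by omega)
        _ ≤ x₂ k := h4

theorem not_isUnit_of_loopCorr {ℓ k : Fin n} {D : Dep n} {β : DepType}
    (h : Dep.LoopCorr ℓ D (.unary ℓ β k)) : ¬ β.IsUnit := by
  cases h <;> simp [DepType.IsUnit]

/-- Derivable dependences are realized; those of a loop that are not due to loop correction are
realized by a fixed number of iterations. -/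
theorem Derives.exists_realizes {C : Cmd n} {P Q : Ctx n} {D : Dep n} (h : Derives C P D Q)
    (hC : C.WellFormed) :
    (∃ c, 0 < c ∧ Realizes (C.Rel .exact) c P D Q) ∧
    ∀ ℓ C', C = .loop ℓ C' →
      (∃ m c, 0 < c ∧ Realizes (relPow (C'.Rel .exact) m) c P D Q) ∨
        ∃ δ k, D = .unary ℓ δ k ∧ k ≠ ℓ := by
  have atomic : ∀ {C : Cmd n} {P Q : Ctx n} {D : Dep n}, Derives C P D Q → C.IsAtomic →
      (∃ c, 0 < c ∧ Realizes (C.Rel .exact) c P D Q) ∧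
      ∀ ℓ C', C = .loop ℓ C' →
        (∃ m c, 0 < c ∧ Realizes (relPow (C'.Rel .exact) m) c P D Q) ∨
          ∃ δ k, D = .unary ℓ δ k ∧ k ≠ ℓ := fun h hC =>
    ⟨⟨2, two_pos, (h.realizes_of_isAtomic hC).imp fun x y hy => hy ▸ hC.rel x⟩,
      fun ℓ C' he => by subst he; exact hC.elim⟩
  induction h with
  | skip hi => exact atomic (.skip hi) trivial
  | zero hi hil => exact atomic (.zero hi hil) trivial
  | var_other hi hil => exact atomic (.var_other hi hil) trivial
  | var_self hr => exact atomic (.var_self hr) trivial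
  | mul_other hi hil => exact atomic (.mul_other hi hil) trivial
  | mul_self hr hs ht => exact atomic (.mul_self hr hs ht) trivial
  | add_other hrs hi hil => exact atomic (.add_other hrs hi hil) trivial
  | add_left hrs hr hs => exact atomic (.add_left hrs hr hs) trivial
  | add_right hrs hr hs => exact atomic (.add_right hrs hr hs) trivial
  | add_both hrs hr hs ht => exact atomic (.add_both hrs hr hs ht) trivial
  | atomic_binary hat hi hi' hj hj' hne hδ₁ hδ₂ h₁ h₂ =>
    exact atomic (.atomic_binary hat hi hi' hj hj' hne hδ₁ hδ₂ h₁ h₂) hat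
  | choose_left h ih =>
    obtain ⟨c, hc, h⟩ := (ih hC.1).1
    exact ⟨⟨c, hc, h.imp fun x y => .inl⟩, by simp⟩
  | choose_right h ih =>
    obtain ⟨c, hc, h⟩ := (ih hC.2).1
    exact ⟨⟨c, hc, h.imp fun x y => .inr⟩, by simp⟩
  | seq _ _ hD ih₁ ih₂ =>
    obtain ⟨c, hc, h⟩ := (ih₁ hC.1).1
    obtain ⟨c', hc', h'⟩ := (ih₂ hC.2).1
    exact ⟨⟨max c c', by omega, (h.mono hc (le_max_left _ _)).comp (by omega)
      (h'.mono hc' (le_max_right _ _)) hD⟩, by simp⟩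
  | loop_zero h ih =>
    obtain ⟨c, hc, h⟩ := (ih trivial).1
    refine ⟨⟨c, hc, h.imp fun x y hxy => ⟨0, Nat.zero_le _, hxy⟩⟩, fun ℓ' C' he => .inl ?_⟩
    exact ⟨0, c, hc, h⟩
  | @loop_iter ℓ C m P D E hℓ _ hE ih =>
    obtain ⟨c, hc, h⟩ := exists_forall_realizes fun k hk => (ih k hk hC.2).1
    have hm := Realizes.relPow_compSeq hc hE h
    refine ⟨⟨max c (m + 1), by omega, fun N hN x hx => ?_⟩, fun ℓ' C' he => .inl ?_⟩
    · obtain ⟨y, h1, h2⟩ := hm.mono hc (le_max_left c (m + 1)) N hN x hx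
      have := hx.2 ℓ hℓ
      exact ⟨y, ⟨m + 1, by omega, h1⟩, h2⟩
    · obtain ⟨rfl, rfl⟩ := Cmd.loop.inj he
      exact ⟨m + 1, c, hc, hm⟩
  | @loop_corr ℓ C P₀ P₁ P₃ D₁ D₂ D₂' D₃ E F hℓ h₁ h₂ h₃ hLC hE hF ih₁ ih₂ ih₃ =>
    have keep : ∀ {P D Q}, Derives (.loop ℓ C) P D Q → Dep.Keeps ℓ D := fun h => h.keeps hC.1
    obtain ⟨k, δ, β, rfl, rfl⟩ : ∃ k δ β, D₂ = .unary k δ k ∧ D₂' = .unary ℓ β k := by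
      cases hLC with
      | onePlus i => exact ⟨_, _, _, rfl, rfl⟩
      | two i => exact ⟨_, _, _, rfl, rfl⟩
    have hkℓ : k ≠ ℓ := hLC.ne_of_keeps (keep h₂)
    have hβ := not_isUnit_of_loopCorr hLC
    cases hE with
    | binary_unary _ _ _ _ _ hα => exact absurd hα hβ
    | unary_unary i _ _ α =>
      -- The preamble ends in the unassigned loop variable, so it is the dependence of type 1 of
      -- that variable on itself.
      obtain ⟨rfl, rfl⟩ := keep h₁ rfl
      rw [DepType.one_sup] at hF
      cases hF with
      | unary_binary _ _ _ _ _ hα => exact absurd hα hβ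
      | unary_unary _ _ q _ γ =>
        have hq : q ≠ i := fun hq => hkℓ (keep h₃ hq).1
        refine ⟨?_, fun ℓ' C' he => .inr ?_⟩
        -- A corrected dependence leads from the loop variable to another one. The preamble ends in
        -- the loop variable, and the cycle and the continuation start at `k`, so none of the three
        -- is corrected and each takes a fixed number of iterations.
        · obtain ⟨m₁, c₁, hc₁, r₁⟩ := ((ih₁ hC).2 i C rfl).resolve_right (by
            rintro ⟨δ, k, he, hk⟩
            simp only [Dep.unary.injEq, true_and] at he
            exact hk he.2.symm)
          obtain ⟨m₂, c₂, hc₂, r₂⟩ := ((ih₂ hC).2 i C rfl).resolve_right (by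
            rintro ⟨δ, k', he, hk⟩
            simp only [Dep.unary.injEq] at he
            exact hkℓ he.1)
          obtain ⟨m₃, c₃, hc₃, r₃⟩ := ((ih₃ hC).2 i C rfl).resolve_right (by
            rintro ⟨δ, k', he, hk⟩
            simp only [Dep.unary.injEq] at he
            exact hkℓ he.1)
          exact Realizes.loopCorr (c := c₁ + c₂ + c₃) (by omega) hℓ h₂.avoids
            (r₁.mono hc₁ (by omega)) (r₂.mono hc₂ (by omega)) (r₃.mono hc₃ (by omega)) hLC
        · obtain ⟨rfl, rfl⟩ := Cmd.loop.inj he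
          exact ⟨_, q, rfl, hq⟩

/-! #### Growth beyond every polynomial -/

theorem exists_eval_const_le (p : MvPolynomial (Fin n) ℕ) :
    ∃ K, ∀ N, 1 ≤ N → MvPolynomial.eval (fun _ => N) p ≤ K * N ^ K := by
  induction p using MvPolynomial.induction_on with
  | C a =>
    refine ⟨a, fun N hN => ?_⟩
    rw [MvPolynomial.eval_C]
    exact Nat.le_mul_of_pos_right _ (pow_pos hN a)
  | add p q hp hq =>
    obtain ⟨K, hK⟩ := hp
    obtain ⟨L, hL⟩ := hq
    refine ⟨K + L, fun N hN => ?_⟩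
    rw [map_add, add_mul]
    exact add_le_add
      ((hK N hN).trans (Nat.mul_le_mul_left K (Nat.pow_le_pow_right hN (by omega))))
      ((hL N hN).trans (Nat.mul_le_mul_left L (Nat.pow_le_pow_right hN (by omega))))
  | mul_X p i hp =>
    obtain ⟨K, hK⟩ := hp
    refine ⟨K + 1, fun N hN => ?_⟩
    rw [map_mul, MvPolynomial.eval_X, pow_succ, ← mul_assoc]
    exact Nat.mul_le_mul_right N
      ((hK N hN).trans (Nat.mul_le_mul_right _ (Nat.le_succ K)))

theorem exists_mul_pow_lt_two_pow (a b : ℕ) : ∃ t, 1 ≤ t ∧ a * t ^ b < 2 ^ t := by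
  have h := (tendsto_pow_const_div_const_pow_of_one_lt b (one_lt_two (α := ℝ))).const_mul (a : ℝ)
  rw [mul_zero] at h
  obtain ⟨t, ht, ht1⟩ := ((h.eventually_lt_const one_pos).and
    (Filter.eventually_ge_atTop 1)).exists
  refine ⟨t, ht1, ?_⟩
  rw [← mul_div_assoc, div_lt_one (by positivity)] at ht
  exact_mod_cast ht

theorem not_polyBounded_of_derives (σ : AssignMode) (C : Cmd n) (hC : C.WellFormed)
    (i j : Fin n) (Q : Ctx n) (h : Derives C ∅ (.unary i .three j) Q) :
    ¬ C.PolyBounded σ j := by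
  rintro ⟨p, hp⟩
  obtain ⟨c, hc, hr⟩ := (h.exists_realizes hC).1
  obtain ⟨K, hK⟩ := exists_eval_const_le p
  -- With all initial values equal to `c * t`, the exponent `a / c` is exactly `t`, and the
  -- polynomial is at most `K * c ^ K * t ^ K`.
  obtain ⟨t, ht, hlt⟩ := exists_mul_pow_lt_two_pow (K * c ^ K) K
  have hct : 1 ≤ c * t := Nat.mul_pos hc ht
  obtain ⟨y, hy, -, -, hexp⟩ := hr (c * t) (Nat.le_mul_of_pos_right _ ht) (fun _ => c * t)
    ⟨by simp, fun _ _ => le_rfl⟩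
  rw [Nat.mul_div_cancel_left _ hc] at hexp
  have := (hp _ y (hy.of_exact σ)).trans (hK _ hct)
  rw [mul_pow, ← mul_assoc] at this
  omega

end LoopLang

theorem theorem2 (n : ℕ) (σ : LoopLang.AssignMode) (C : LoopLang.Cmd n) (hC : C.WellFormed)
    (j : Fin n) :
    ((∃ (i : Fin n) (Q : LoopLang.Ctx n),
        LoopLang.Derives C ∅ (LoopLang.Dep.unary i LoopLang.DepType.three j) Q) →
      ¬ C.PolyBounded σ j) ∧
    ((¬ ∃ (i : Fin n) (Q : LoopLang.Ctx n),
        LoopLang.Derives C ∅ (LoopLang.Dep.unary i LoopLang.DepType.three j) Q) →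
      C.PolyBounded σ j) := by
  constructor
  · rintro ⟨i, Q, h⟩
    exact LoopLang.not_polyBounded_of_derives σ C hC i j Q h
  · exact LoopLang.polyBounded_of_not_derives σ C hC j
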